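/- **Setting.** Let $1\le r\le H$, $K=\binom{H}{r}$, $N\ge K$ and $0\le M\le N$ (with $M$ real). In the combination network a server with $N$ files of $B$ independent uniform bits is connected to $H$ relays, and each of the $K$ users is connected to a different set of $r$ relays; $\mathcal H_k$ is the set of relays of user $k$, and $\mathcal K_{\mathcal Q}=\{k:\mathcal H_k\subseteq \mathcal Q\}$ for $\mathcal Q\subseteq[H]$. A *scheme with uncoded placement* consists of a file size $B\ge 1$; for every user $k$ a set of at most $MB$ bits of the files, copied into its cache; and, for every demand vector $\mathbf d\in[N]^K$, messages $X_h$ (a fixed number of bits, a function of the files) from the server to the relays $h$, messages $X_{h\to k}$ (a fixed number of bits, a function of $X_h$) from relay $h$ to the users $k$ with $h\in\mathcal H_k$, and for every user $k$ an estimate of file $F_{d_k}$ computed from its cache and $(X_{h\to k})_{h\in\mathcal H_k}$. The *load* of the scheme is the maximum over $\mathbf d$ and all links of the number of transmitted bits divided by $B$; its *error probabilities* are the probabilities, for each $\mathbf d$ and $k$, that the estimate of user $k$ is not $F_{d_k}$. A number $R$ is achievable if for every $\varepsilon>0$ there is, for some $B$, a scheme of load at most $R$ all of whose error probabilities are at most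 $\varepsilon$; $R^\star_u=R^\star_u(M)$ is the infimum of the achievable $R$. For a scheme let $F_{i,\mathcal W}$ be the sub-file of the bits of file $i$ cached by exactly the users in $\mathcal W\subseteq[K]$, and $$x_{\mathcal W}=\frac1{NB}\sum_{i\in[N]}|F_{i,\mathcal W}| .$$ Let $\mathcal T_{\mathbf d}=\{F_{d_k,\mathcal W}:k\in[K],\ k\notin\mathcal W\}$ be the set of requested sub-files, and for $\mathcal S\subseteq\mathcal T_{\mathbf d}$ let $\mathcal S^c=\mathcal T_{\mathbf d}\setminus\mathcal S$. For a permutation $\mathbf p$ of $[K]$, $\mathcal Q\subseteq[H]$ and $\mathbf d$ with distinct entries, let $(v_1,\dots,v_m)$ be obtained from $\mathbf p$ by deleting the users in $\mathcal K_{\mathcal Q}$ and $$\mathcal S_{\mathbf d,\mathcal Q,\mathbf p}=\bigcup_{i\in[m]}\big\{F_{d_{v_i},\mathcal W}:\mathcal W\subseteq([K]\setminus\mathcal K_{\mathcal Q})\setminus\{v_1,\dots,v_i\}\big\},$$ $$y_{\mathcal Q,\mathbf p}=\frac{(N-K)!}{N!\,B}\sum_{\mathbf d\text{ with distinct entries}}H\big(X_{\mathcal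 Q}\,\big|\,\mathcal S_{\mathbf d,\mathcal Q,\mathbf p}^{\,c}\big),\qquad y_{\mathcal Q}=\max_{\mathbf p}y_{\mathcal Q,\mathbf p},$$ where $X_{\mathcal Q}=(X_h)_{h\in\mathcal Q}$ is the tuple of messages under the demand vector $\mathbf d$, and entropies are in bits. Finally, for $\mathcal W_1\subseteq[K]$ put $$c(\mathcal W_1,l)=\max\Big\{\binom{H-1}{l-1}-\big|\{\mathcal Q\subseteq[H]:|\mathcal Q|=l,\ \mathcal K_{\mathcal Q}\nsubseteq[K]\setminus\mathcal W_1\}\big|,\,0\Big\}.$$ Call $(R,(x_{\mathcal W})_{\mathcal W\subseteq[K]},(y_{\mathcal Q})_{\mathcal Q\subseteq[H]})$ *asymptotic* if there is a sequence of schemes with uncoded placement, in which all the messages $X_h$ are functions of the requested sub-files $\mathcal T_{\mathbf d}$, whose error probabilities tend to $0$, whose loads tend to $R$, and whose values of $x_{\mathcal W}$ and $y_{\mathcal Q}$ tend to the given ones. **Theorem.** There are $x$ and $y$ such that $(R^\star_u,x,y)$ is asymptotic. Every asymptotic $(R,x,y)$, in particular every one with $R=R^\star_u$, satisfies: 1.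 $\sum_{\mathcal W\subseteq[K]}x_{\mathcal W}=1$, and $\sum_{\mathcal W\ni k}x_{\mathcal W}\le M/N$ for every $k\in[K]$; 2. for every $b\in[r:H]$, every $\mathcal Q\subseteq[H]$ with $|\mathcal Q|=b$ and every permutation $(p_1,\dots,p_{|\mathcal K_{\mathcal Q}|})$ of $\mathcal K_{\mathcal Q}$, $$|\mathcal Q|\,R\ \ge\ \sum_{i=1}^{|\mathcal K_{\mathcal Q}|}\ \sum_{\mathcal W\subseteq[K]\setminus\{p_1,\dots,p_i\}}x_{\mathcal W}\ +\ y_{\mathcal Q};$$ 3. for every $b\in[r:H]$ and every permutation $(p_1,\dots,p_K)$ of $[K]$, $$\sum_{\mathcal Q\subseteq[H]:|\mathcal Q|=b}y_{\mathcal Q}\ \ge\ \sum_{i=1}^{K}\ \sum_{\mathcal W\subseteq[K]\setminus\{p_1,\dots,p_i\}}c\big(\{p_i\}\cup\mathcal W,\,b\big)\,x_{\mathcal W}.$$ -/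

import Mathlib

open Filter Topology

namespace CombNet

noncomputable section

/-! ### The combination network -/

/-- The users of the combination network with `H` relays: one user for each set of `r` relays, the
user being identified with the set of relays it is connected to. So `K = H.choose r`. -/
abbrev User (H r : ℕ) : Type := {s : Finset (Fin H) // s.card = r}

/-- The links from relays to users: pairs (relay `h`, user `k`) with `k` connected to `h`. -/
abbrev Link (H r : ℕ) : Type := {e : Fin H × User H r // e.1 ∈ e.2.1}

/-- A demand vector: user `k` demands the file with index `d k`. -/
abbrev Demand (H r N : ℕ) : Type := User H r → Fin N

/-- The contents of the `N` files of `B` bits each; `F (i, j)` is the `j`-th bit of file `i`. -/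
abbrev Library (N B : ℕ) : Type := Fin N × Fin B → Bool

/-- `K_J`: the users all of whose relays are in `J`. -/
def usersOf {H : ℕ} (r : ℕ) (J : Finset (Fin H)) : Finset (User H r) :=
  Finset.univ.filter fun k => k.1 ⊆ J

/-- The list `p` is a permutation `(p₁, …, p_{|A|})` of the elements of the finite set `A`. -/
def IsPerm {α : Type} [DecidableEq α] (p : List α) (A : Finset α) : Prop :=
  p.Nodup ∧ p.toFinset = A

/-! ### Conditional entropy of random variables on a finite, uniformly distributed sample space -/

/-- The probability of the event `E` under the uniform distribution on `Ω`. -/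
def unifProb {Ω : Type} [Fintype Ω] (E : Ω → Prop) : ℝ :=
  (Nat.card {ω : Ω // E ω} : ℝ) / (Fintype.card Ω : ℝ)

/-- The conditional Shannon entropy `H(X | Y)` in bits,
`- ∑ P(X = a, Y = b) log₂ (P(X = a, Y = b) / P(Y = b))`. -/
def condEntropy {Ω α β : Type} [Fintype Ω] [Fintype α] [Fintype β] (X : Ω → α) (Y : Ω → β) : ℝ :=
  -∑ a, ∑ b, unifProb (fun ω => X ω = a ∧ Y ω = b) *
    Real.logb 2 (unifProb (fun ω => X ω = a ∧ Y ω = b) / unifProb (fun ω => Y ω = b))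

/-! ### Caching schemes with uncoded placement -/

/-- A caching scheme with uncoded placement for the combination network with `H` relays, `r` relays
per user, `N` files and cache size `M`, for some file size `B`. -/
structure Scheme (H r N : ℕ) (M : ℝ) where
  /-- number of bits of each file -/
  B : ℕ
  B_pos : 0 < B
  /-- the bits of the files that user `k` copies into its cache -/
  cache : User H r → Finset (Fin N × Fin B)
  cache_card : ∀ k, ((cache k).card : ℝ) ≤ M * B
  /-- number of bits sent by the server to relay `h` under the demand vector `d` -/
  relayBits : Demand H r N → Fin H → ℕ
  /-- the message `X_h` sent by the server to relay `h` -/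
  toRelay : ∀ (d : Demand H r N) (h : Fin H), Library N B → (Fin (relayBits d h) → Bool)
  /-- number of bits sent by relay `h` to user `k` under the demand vector `d` -/
  linkBits : Demand H r N → Link H r → ℕ
  /-- the message `X_{h → k}`, which the relay computes from `X_h` -/
  toUser : ∀ (d : Demand H r N) (e : Link H r),
    (Fin (relayBits d e.1.1) → Bool) → (Fin (linkBits d e) → Bool)
  /-- the estimate by user `k` of its demanded file, computed from the contents of its cache and
  from the messages received from the relays it is connected to -/
  decode : ∀ (d : Demand H r N) (k : User H r), ({b // b ∈ cache k} → Bool) →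
    (∀ h : {h // h ∈ k.1}, Fin (linkBits d ⟨(h.1, k), h.2⟩) → Bool) → (Fin B → Bool)

namespace Scheme

variable {H r N : ℕ} {M : ℝ} (σ : Scheme H r N M)

/-- The max-link load: the maximum over all demand vectors and all links of the number of
transmitted bits, divided by the file size. -/
def load : ℝ :=
  ((max
    (Finset.univ.sup fun dh : Demand H r N × Fin H => σ.relayBits dh.1 dh.2)
    (Finset.univ.sup fun de : Demand H r N × Link H r => σ.linkBits de.1 de.2) : ℕ) : ℝ) / σ.B

/-- What user `k` outputs when the demand vector is `d` and the files have contents `F`. -/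
def output (d : Demand H r N) (k : User H r) (F : Library N σ.B) : Fin σ.B → Bool :=
  σ.decode d k (fun b => F b.1)
    (fun h => σ.toUser d ⟨(h.1, k), h.2⟩ (σ.toRelay d h.1 F))

/-- The probability, for independent uniform bits, that user `k` does not recover its file. -/
def errorProb (d : Demand H r N) (k : User H r) : ℝ :=
  unifProb fun F : Library N σ.B => σ.output d k F ≠ fun j => F (d k, j)

/-- The sub-file `F_{i,W}`: the positions of the bits of file `i` cached by the users in `W` and by
no other user. -/
def subfile (i : Fin N) (W : Finset (User H r)) : Finset (Fin N × Fin σ.B) :=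
  Finset.univ.filter fun b => b.1 = i ∧ ∀ k, b ∈ σ.cache k ↔ k ∈ W

/-- The random variable `X_Q = (X_h : h ∈ Q)`. -/
def msgs (d : Demand H r N) (Q : Finset (Fin H)) (F : Library N σ.B) :
    ∀ h : {h // h ∈ Q}, Fin (σ.relayBits d h.1) → Bool :=
  fun h => σ.toRelay d h.1 F

end Scheme

/-! Sets of sub-files are represented by the sets of the indices `(i, W)` of their elements. -/

/-- `T_{d,Z}`: the requested sub-files `F_{d_k,W}`, with `k ∉ W`. -/
def requested {H r N : ℕ} (d : Demand H r N) : Finset (Fin N × Finset (User H r)) :=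
  Finset.univ.filter fun s => ∃ k, s.1 = d k ∧ k ∉ s.2

/-- `f(d, S', v)`: the union over `i` of the sets `{F_{d_{v_i},W} : W ⊆ S' \ {v_1, …, v_i}}`. -/
def acyclicSet {H r N : ℕ} (d : Demand H r N) (S' : Finset (User H r)) (v : List (User H r)) :
    Finset (Fin N × Finset (User H r)) :=
  Finset.univ.biUnion fun i : Fin v.length =>
    ((S' \ (v.take (i + 1)).toFinset).powerset).image fun W => (d (v.get i), W)

/-- `g(S, p)`: the vector obtained from `p` by removing the elements that are not in `S`. -/
def subvector {α : Type} [DecidableEq α] (S : Finset α) (p : List α) : List α :=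
  p.filter fun k => k ∈ S

/-- The coefficient `c(W₁, l)`. -/
def coeff {H r : ℕ} (W₁ : Finset (User H r)) (l : ℕ) : ℝ :=
  max (((H - 1).choose (l - 1) : ℝ) -
    ((Finset.univ.filter fun Q : Finset (Fin H) =>
      Q.card = l ∧ ¬ usersOf r Q ⊆ Finset.univ \ W₁).card : ℝ)) 0

namespace Scheme

variable {H r N : ℕ} {M : ℝ} (σ : Scheme H r N M)

/-- The positions of the bits of the sub-files in the set `S` of sub-files. -/
def bitsOf (S : Finset (Fin N × Finset (User H r))) : Finset (Fin N × Fin σ.B) :=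
  S.biUnion fun s => σ.subfile s.1 s.2

/-- The messages sent by the server are functions of the requested sub-files. -/
def OnlyRequested : Prop :=
  ∀ (d : Demand H r N) (h : Fin H) (F F' : Library N σ.B),
    (∀ b ∈ σ.bitsOf (requested d), F b = F' b) → σ.toRelay d h F = σ.toRelay d h F'

/-- `H(X_Q | Sᶜ)`, where `Sᶜ = T_{d,Z} \ S`. -/
def entropyGivenCompl (d : Demand H r N) (Q : Finset (Fin H))
    (S : Finset (Fin N × Finset (User H r))) : ℝ :=
  condEntropy (σ.msgs d Q)
    (fun (F : Library N σ.B) (b : {b // b ∈ σ.bitsOf (requested d \ S)}) => F b.1)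

/-- `x_W`: the fraction of the bits of the library cached exactly by the users in `W`. -/
def x (W : Finset (User H r)) : ℝ :=
  (∑ i : Fin N, ((σ.subfile i W).card : ℝ)) / ((N : ℝ) * σ.B)

/-- `y_{Q,p}`, for a permutation `p` of the set of all users: the average over the
`N! / (N - K)!` demand vectors with distinct entries of `H(X_Q | S₂ᶜ) / B`, where
`S₂ = f(d, [K] \ K_Q, g([K] \ K_Q, p))`. -/
def yPerm (Q : Finset (Fin H)) (p : List (User H r)) : ℝ :=
  (∑ d ∈ Finset.univ.filter (fun d : Demand H r N => Function.Injective d),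
    σ.entropyGivenCompl d Q
      (acyclicSet d (Finset.univ \ usersOf r Q) (subvector (Finset.univ \ usersOf r Q) p))) /
  ((σ.B : ℝ) * (N.descFactorial (H.choose r) : ℝ))

/-- `y_Q`: the maximum of `y_{Q,p}` over the (finitely many) permutations `p` of all users. -/
def y (Q : Finset (Fin H)) : ℝ :=
  ⨆ p : {p : List (User H r) // IsPerm p Finset.univ}, σ.yPerm Q p.1

end Scheme

/-! ### The optimal load -/

/-- The load `R` is achievable with uncoded placement: for every `ε > 0` there is, for some file
size, a scheme of load at most `R` in which every user recovers its file with probability at least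
`1 - ε`, whatever the demands. -/
def Achievable (H r N : ℕ) (M R : ℝ) : Prop :=
  ∀ ε > 0, ∃ σ : Scheme H r N M, σ.load ≤ R ∧ ∀ d k, σ.errorProb d k ≤ ε

/-- The optimal max-link load `R*_u(M)` under the constraint of uncoded placement. -/
def optimalLoad (H r N : ℕ) (M : ℝ) : ℝ :=
  sInf {R : ℝ | Achievable H r N M R}

/-- `R`, `x` and `y` are the limits of the load, of the `x_W` and of the `y_Q` along a sequence of
schemes with uncoded placement, with messages that are functions of the requested sub-files, and
with vanishing probability of error. -/
def IsAsymptotic (H r N : ℕ) (M R : ℝ) (x : Finset (User H r) → ℝ) (y : Finset (Fin H) → ℝ) :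
    Prop :=
  ∃ σ : ℕ → Scheme H r N M,
    (∀ n, (σ n).OnlyRequested) ∧
    (∀ d k, Tendsto (fun n => (σ n).errorProb d k) atTop (𝓝 0)) ∧
    Tendsto (fun n => (σ n).load) atTop (𝓝 R) ∧
    (∀ W, Tendsto (fun n => (σ n).x W) atTop (𝓝 (x W))) ∧
    (∀ Q, Tendsto (fun n => (σ n).y Q) atTop (𝓝 (y Q)))

end

end CombNet

/-! Both families of bounds come from users decoding one after another. Fix a demand vector with
distinct entries and a list of users. A bit of the acyclic set of the list that is cached by some
user of the list belongs to a file demanded by an earlier user (`exists_earlier_of_mem_acyclicSet`).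
Hence the messages of the relevant relays, together with the requested bits outside the set,
determine the whole set, up to a Fano loss per user (`entropy_decode_le`,
`entropy_decode_acyclic_le`).

For the cut `Q`, let the users of `K_Q` decode their acyclic set S₁, and let S₂ be the set in the
definition of `y`. Conditioning on the requested bits outside S₁ ∪ S₂ gives H(X_Q) ≥ |S₁| + H(X_Q |
S₂ᶜ) up to that loss (`card_bitsOf_acyclicSet_add_le`).

For the sum of the `y_Q`, let P be the sub-files of the acyclic set of all users whose coefficient
is positive. All messages together have entropy about |P| or more given Pᶜ, and Han's inequality
conditioned on Pᶜ shares this among the `Q` of size `b`. Replacing Pᶜ by the condition in `y_Q`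
costs at most |P \ S_Q| bits; summed over `Q`, this gives the number subtracted in `coeff`
(`sum_coeff_mul_card_le`).

Averaging over distinct demands turns sizes of sub-files into `x_W`. The Fano loss per file bit
vanishes in the limit (`le_of_equivocation_bound`).

For existence, near-optimal schemes are altered so that the messages ignore unrequested bits
(`exists_onlyRequested`); compactness then provides a convergent subsequence. -/

namespace CombNet
noncomputable section

/-! ### Shannon entropy on a finite uniform sample space -/

section Entropy

variable {Ω α β γ δ : Type} [Fintype Ω]

open Classical in
/-- The number of sample points at which `X` takes the same value as at `ω`. -/
def fiberCard (X : Ω → α) (ω : Ω) : ℕ := (Finset.univ.filter fun ω' => X ω' = X ω).card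

/-- The Shannon entropy of `X`, in bits. -/
def entropy (X : Ω → α) : ℝ :=
  (∑ ω, Real.logb 2 (Fintype.card Ω / fiberCard X ω)) / Fintype.card Ω

lemma fiberCard_pos (X : Ω → α) (ω : Ω) : (0 : ℝ) < fiberCard X ω := by
  classical
  unfold fiberCard
  exact_mod_cast Finset.card_pos.mpr ⟨ω, by simp⟩

lemma fiberCard_le_of_factorsThrough {X : Ω → α} {Y : Ω → β} (h : Y.FactorsThrough X) (ω : Ω) :
    (fiberCard X ω : ℝ) ≤ fiberCard Y ω := by
  classical
  unfold fiberCard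
  exact_mod_cast Finset.card_le_card fun ω' hω' => by
    simp only [Finset.mem_filter, Finset.mem_univ, true_and] at hω' ⊢
    exact h hω'

lemma card_pos_real [Nonempty Ω] : (0 : ℝ) < Fintype.card Ω := by
  exact_mod_cast Fintype.card_pos

lemma entropy_le_of_factorsThrough [Nonempty Ω] {X : Ω → α} {Y : Ω → β}
    (h : Y.FactorsThrough X) : entropy Y ≤ entropy X := by
  unfold entropy
  have := card_pos_real (Ω := Ω)
  refine div_le_div_of_nonneg_right (Finset.sum_le_sum fun ω _ => ?_) this.le
  exact Real.logb_le_logb_of_le one_lt_two (div_pos this (fiberCard_pos _ _))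
    (div_le_div_of_nonneg_left this.le (fiberCard_pos _ _) (fiberCard_le_of_factorsThrough h ω))

lemma entropy_congr [Nonempty Ω] {X : Ω → α} {Y : Ω → β}
    (h : Y.FactorsThrough X) (h' : X.FactorsThrough Y) : entropy Y = entropy X :=
  le_antisymm (entropy_le_of_factorsThrough h) (entropy_le_of_factorsThrough h')

lemma entropy_const [Nonempty Ω] (c : α) : entropy (fun _ : Ω => c) = 0 := by
  have := card_pos_real (Ω := Ω)
  simp [entropy, fiberCard, this.ne']

lemma entropy_sub_entropy [Nonempty Ω] (Y : Ω → β) (Z : Ω → γ) :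
    entropy (fun ω => (Y ω, Z ω)) - entropy Z =
      (∑ ω, Real.logb 2 (fiberCard Z ω / fiberCard (fun ω => (Y ω, Z ω)) ω)) /
        Fintype.card Ω := by
  unfold entropy
  rw [← sub_div, ← Finset.sum_sub_distrib]
  congr 1
  refine Finset.sum_congr rfl fun ω _ => ?_
  have h0 := (card_pos_real (Ω := Ω)).ne'
  have h1 := (fiberCard_pos Z ω).ne'
  have h2 := (fiberCard_pos (fun ω => (Y ω, Z ω)) ω).ne'
  rw [Real.logb_div h0 h2, Real.logb_div h0 h1, Real.logb_div h1 h2]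
  ring

/-- The factor after `q` is the inverse of P(Y | Z), so this is the normalization bound behind
Gibbs' inequality. Writing `fiberCard Z ω` as a sum over points `ω₁` with the same value of `Z` and
exchanging sums, each value of `Y` contributes `q y (Z ω₁)` at most once per `ω₁`. -/
lemma sum_mul_fiberCard_div_le [Fintype β] (Y : Ω → β) (Z : Ω → γ)
    (q : β → γ → ℝ) (hq : ∀ y z, 0 ≤ q y z) (hsum : ∀ z, ∑ y, q y z ≤ 1) :
    ∑ ω, q (Y ω) (Z ω) * (fiberCard Z ω / fiberCard (fun ω => (Y ω, Z ω)) ω) ≤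
      Fintype.card Ω := by
  classical
  set n : Ω → ℝ := fun ω => fiberCard (fun ω => (Y ω, Z ω)) ω with hn
  calc ∑ ω, q (Y ω) (Z ω) * (fiberCard Z ω / n ω)
      = ∑ ω, ∑ ω₁, if Z ω₁ = Z ω then q (Y ω) (Z ω) / n ω else 0 := by
        refine Finset.sum_congr rfl fun ω _ => ?_
        rw [← Finset.sum_filter, Finset.sum_const, nsmul_eq_mul]
        simp only [fiberCard]
        ring
    _ = ∑ ω₁, ∑ ω, if Z ω₁ = Z ω then q (Y ω) (Z ω) / n ω else 0 := Finset.sum_comm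
    _ ≤ ∑ ω₁ : Ω, (1 : ℝ) := by
        refine Finset.sum_le_sum fun ω₁ _ => (?_ : _ ≤ (1 : ℝ))
        refine le_trans ?_ (hsum (Z ω₁))
        rw [← Finset.sum_fiberwise (s := Finset.univ) (g := Y)]
        refine Finset.sum_le_sum fun y _ => ?_
        rw [← Finset.sum_filter, Finset.filter_filter]
        set A := Finset.univ.filter fun ω => Y ω = y ∧ Z ω₁ = Z ω with hA
        have key : ∀ ω ∈ A, q (Y ω) (Z ω) / n ω = q y (Z ω₁) / A.card := by
          intro ω hω
          simp only [hA, Finset.mem_filter, Finset.mem_univ, true_and] at hω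
          obtain ⟨h1, h2⟩ := hω
          have : n ω = A.card := by
            simp only [hn, fiberCard, hA]
            congr 2
            ext ω'
            simp only [Finset.mem_filter, Finset.mem_univ, true_and, Prod.mk.injEq]
            rw [h1, ← h2, eq_comm (a := Z ω')]
          rw [this, h1, h2]
        rw [Finset.sum_congr rfl key, Finset.sum_const, nsmul_eq_mul]
        rcases Nat.eq_zero_or_pos A.card with h | h
        · simp [h, hq]
        · have : (A.card : ℝ) ≠ 0 := by positivity
          rw [mul_div_cancel₀ _ this]
    _ = Fintype.card Ω := by simp

/-- Gibbs' inequality. -/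
lemma entropy_sub_entropy_le [Nonempty Ω] [Fintype β] (Y : Ω → β) (Z : Ω → γ)
    (q : β → γ → ℝ) (hq : ∀ y z, 0 ≤ q y z) (hsum : ∀ z, ∑ y, q y z ≤ 1)
    (hpos : ∀ ω, 0 < q (Y ω) (Z ω)) :
    entropy (fun ω => (Y ω, Z ω)) - entropy Z ≤
      (∑ ω, -Real.logb 2 (q (Y ω) (Z ω))) / Fintype.card Ω := by
  rw [entropy_sub_entropy]
  refine div_le_div_of_nonneg_right ?_ (card_pos_real (Ω := Ω)).le
  rw [← sub_nonpos, ← Finset.sum_sub_distrib]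
  have hlog2 : 0 < Real.log 2 := Real.log_pos one_lt_two
  set t : Ω → ℝ := fun ω =>
    q (Y ω) (Z ω) * (fiberCard Z ω / fiberCard (fun ω => (Y ω, Z ω)) ω) with ht
  -- This is log t ≤ t - 1 for the likelihood ratio `t ω`, whose mean is at most 1.
  have key : ∀ ω, Real.logb 2 (fiberCard Z ω / fiberCard (fun ω => (Y ω, Z ω)) ω) -
      -Real.logb 2 (q (Y ω) (Z ω)) ≤ (t ω - 1) / Real.log 2 := by
    intro ω
    have h3 : (0 : ℝ) < fiberCard Z ω / fiberCard (fun ω => (Y ω, Z ω)) ω :=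
      div_pos (fiberCard_pos Z ω) (fiberCard_pos _ ω)
    rw [sub_neg_eq_add, add_comm, ← Real.logb_mul (hpos ω).ne' h3.ne']
    exact div_le_div_of_nonneg_right
      (Real.log_le_sub_one_of_pos (mul_pos (hpos ω) h3)) hlog2.le
  refine (Finset.sum_le_sum fun ω _ => key ω).trans ?_
  rw [← Finset.sum_div]
  refine div_nonpos_of_nonpos_of_nonneg ?_ hlog2.le
  rw [Finset.sum_sub_distrib]
  have := sum_mul_fiberCard_div_le Y Z q hq hsum
  simp only [Finset.sum_const, Finset.card_univ, nsmul_eq_mul, mul_one]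
  linarith

/-- Gibbs' inequality with the uniform law for `q` and a trivial `Z`. -/
lemma entropy_le_logb_card [Nonempty Ω] [Fintype β] (Y : Ω → β) :
    entropy Y ≤ Real.logb 2 (Fintype.card β) := by
  have : Nonempty β := ⟨Y (Classical.arbitrary Ω)⟩
  have hβ := card_pos_real (Ω := β)
  have hΩ := card_pos_real (Ω := Ω)
  have h := entropy_sub_entropy_le Y (fun _ => ()) (fun _ _ => 1 / (Fintype.card β : ℝ))
    (fun _ _ => by positivity) (fun _ => by simp) (fun _ => by positivity)
  rw [entropy_const, sub_zero] at h
  have h1 : entropy Y ≤ entropy (fun ω => (Y ω, ())) :=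
    entropy_le_of_factorsThrough fun a b hab => (Prod.ext_iff.1 hab).1
  have h2 : (∑ _ω : Ω, -Real.logb 2 (1 / (Fintype.card β : ℝ))) / (Fintype.card Ω : ℝ) =
      Real.logb 2 (Fintype.card β) := by
    rw [Finset.sum_const, Finset.card_univ, nsmul_eq_mul, one_div, Real.logb_inv, neg_neg,
      mul_div_cancel_left₀ _ hΩ.ne']
  exact h1.trans (h.trans h2.le)

/-- Conditioning reduces entropy: in Gibbs' inequality for `X` given `(Y, Z)`, take for `q` the true
conditional law of `X` given `Z` alone. -/
lemma entropy_triple_add_le [Nonempty Ω] [Fintype α] (X : Ω → α) (Y : Ω → β) (Z : Ω → γ) :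
    entropy (fun ω => (X ω, (Y ω, Z ω))) + entropy Z ≤
      entropy (fun ω => (X ω, Z ω)) + entropy (fun ω => (Y ω, Z ω)) := by
  classical
  let c : γ → ℝ := fun z => (Finset.univ.filter fun ω => Z ω = z).card
  let e : α → γ → ℝ := fun x z => (Finset.univ.filter fun ω => X ω = x ∧ Z ω = z).card
  have he : ∀ ω, e (X ω) (Z ω) = fiberCard (fun ω => (X ω, Z ω)) ω := by
    intro ω
    simp [e, fiberCard, Prod.ext_iff]
  have hc : ∀ ω, c (Z ω) = fiberCard Z ω := by
    intro ω
    simp [c, fiberCard]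
  have h := entropy_sub_entropy_le X (fun ω => (Y ω, Z ω)) (fun x yz => e x yz.2 / c yz.2)
    (fun _ _ => by positivity)
    (fun z => by
      rw [← Finset.sum_div]
      refine div_le_one_of_le₀ (le_of_eq ?_) (by positivity)
      simp only [e, c]
      rw [Finset.card_eq_sum_card_fiberwise (f := X) (t := Finset.univ) (fun _ _ => by simp)]
      push_cast
      refine Finset.sum_congr rfl fun x _ => ?_
      rw [Finset.filter_filter]
      congr 2
      ext; simp [and_comm])
    (fun ω => by
      simp only [he, hc]
      exact div_pos (fiberCard_pos _ _) (fiberCard_pos _ _))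
  have h2 := entropy_sub_entropy X Z
  have h3 : (∑ ω, -Real.logb 2 (e (X ω) (Z ω) / c (Z ω))) / (Fintype.card Ω : ℝ) =
      entropy (fun ω => (X ω, Z ω)) - entropy Z := by
    rw [h2]
    congr 1
    refine Finset.sum_congr rfl fun ω _ => ?_
    rw [he, hc, ← Real.logb_inv, inv_div]
  simp only at h
  rw [h3] at h
  linarith

/-- Submodularity of entropy. -/
lemma entropy_submodular [Nonempty Ω] [Fintype α] {A : Ω → α} {B : Ω → β} {C : Ω → γ}
    {D : Ω → δ} (hCA : C.FactorsThrough A) (hCB : C.FactorsThrough B)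
    (hD : D.FactorsThrough fun ω => (A ω, B ω)) :
    entropy D + entropy C ≤ entropy A + entropy B := by
  have h := entropy_triple_add_le A B C
  have h1 : entropy (fun ω => (A ω, C ω)) = entropy A :=
    entropy_congr (fun a b hab => Prod.ext hab (hCA hab)) (fun a b hab => (Prod.ext_iff.1 hab).1)
  have h2 : entropy (fun ω => (B ω, C ω)) = entropy B :=
    entropy_congr (fun a b hab => Prod.ext hab (hCB hab)) (fun a b hab => (Prod.ext_iff.1 hab).1)
  have h3 : entropy D ≤ entropy (fun ω => (A ω, (B ω, C ω))) :=
    entropy_le_of_factorsThrough fun a b hab => hD <| by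
      simp only [Prod.mk.injEq] at hab ⊢
      exact ⟨hab.1, hab.2.1⟩
  linarith

lemma entropy_le_add [Nonempty Ω] [Fintype α] {A : Ω → α} {B : Ω → β}
    {D : Ω → δ} (hD : D.FactorsThrough fun ω => (A ω, B ω)) :
    entropy D ≤ entropy A + entropy B := by
  have h := entropy_submodular (C := fun _ : Ω => ()) (fun _ _ _ => rfl) (fun _ _ _ => rfl) hD
  rwa [entropy_const, add_zero] at h

lemma unifProb_eq_card (E : Ω → Prop) [DecidablePred E] :
    unifProb E = ((Finset.univ.filter E).card : ℝ) / Fintype.card Ω := by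
  unfold unifProb
  rw [Nat.card_eq_fintype_card, Fintype.card_subtype]

lemma unifProb_nonneg (E : Ω → Prop) : 0 ≤ unifProb E := by
  unfold unifProb; positivity

lemma unifProb_mono {E E' : Ω → Prop} (h : ∀ ω, E ω → E' ω) : unifProb E ≤ unifProb E' := by
  classical
  rw [unifProb_eq_card, unifProb_eq_card]
  refine div_le_div_of_nonneg_right ?_ (by positivity)
  exact_mod_cast Finset.card_le_card (Finset.monotone_filter_right _ fun ω _ => h ω)

/-- Fano's inequality, with the binary entropy of the error probability replaced by a cross
entropy with parameter `δ`. -/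
lemma entropy_fano [Nonempty Ω] [Fintype β] (Y Y' : Ω → β) (Z : Ω → γ)
    (hY' : Y'.FactorsThrough Z) {δ : ℝ} (h0 : 0 < δ) (h1 : δ < 1) :
    entropy (fun ω => (Y ω, Z ω)) ≤ entropy Z - Real.logb 2 (1 - δ) +
      unifProb (fun ω => Y' ω ≠ Y ω) * (Real.logb 2 (Fintype.card β) - Real.logb 2 δ) := by
  classical
  have : Nonempty β := ⟨Y (Classical.arbitrary Ω)⟩
  have hβ := card_pos_real (Ω := β)
  have hΩ := card_pos_real (Ω := Ω)
  obtain ⟨g, hg⟩ : ∃ g : γ → β, ∀ ω, Y' ω = g (Z ω) := by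
    refine ⟨fun z => if h : ∃ ω, Z ω = z then Y' h.choose else Classical.arbitrary β, fun ω => ?_⟩
    have h : ∃ ω', Z ω' = Z ω := ⟨ω, rfl⟩
    simp only [dif_pos h]
    exact (hY' h.choose_spec).symm
  -- Mass 1 - δ on the decoder's guess, the rest spread uniformly; the total is slightly below 1,
  -- which Gibbs' inequality allows.
  let q : β → γ → ℝ := fun y z => if g z = y then 1 - δ else δ / Fintype.card β
  have hq : ∀ y z, 0 < q y z := by
    intro y z
    simp only [q]
    split_ifs
    · linarith
    · positivity
  have h := entropy_sub_entropy_le Y Z q (fun y z => (hq y z).le)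
    (fun z => by
      calc ∑ y, q y z ≤ ∑ y, ((if g z = y then 1 - δ else 0) + δ / Fintype.card β) := by
            refine Finset.sum_le_sum fun y _ => ?_
            simp only [q]
            split_ifs
            · have : 0 ≤ δ / (Fintype.card β : ℝ) := by positivity
              linarith
            · simp
        _ = 1 := by
            rw [Finset.sum_add_distrib, Finset.sum_ite_eq]
            simp only [Finset.mem_univ, if_true, Finset.sum_const, Finset.card_univ, nsmul_eq_mul]
            field_simp
            ring)
    (fun ω => hq _ _)
  have hle : ∑ ω, -Real.logb 2 (q (Y ω) (Z ω)) ≤ ∑ ω, (-Real.logb 2 (1 - δ) +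
      if Y' ω ≠ Y ω then Real.logb 2 (Fintype.card β) - Real.logb 2 δ else 0) := by
    refine Finset.sum_le_sum fun ω _ => ?_
    simp only [q, ← hg]
    have hneg : Real.logb 2 (1 - δ) ≤ 0 :=
      Real.logb_nonpos one_lt_two (by linarith) (by linarith)
    by_cases hY : Y' ω = Y ω
    · simp [hY]
    · simp only [hY, if_false, ne_eq, not_false_eq_true, if_true]
      rw [Real.logb_div h0.ne' hβ.ne']
      linarith
  have := h.trans (div_le_div_of_nonneg_right hle hΩ.le)
  rw [Finset.sum_add_distrib, ← Finset.sum_filter, Finset.sum_const, Finset.sum_const,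
    nsmul_eq_mul, nsmul_eq_mul, Finset.card_univ, add_div, mul_div_cancel_left₀ _ hΩ.ne',
    mul_div_right_comm, ← unifProb_eq_card] at this
  linarith

/-- Link between the definition in the statement, a sum over values, and the sum over sample points
used in the proof; each value pair is charged to the sample points where it is attained. -/
lemma condEntropy_eq [Nonempty Ω] [Fintype α] [Fintype β] (X : Ω → α) (Y : Ω → β) :
    condEntropy X Y = entropy (fun ω => (X ω, Y ω)) - entropy Y := by
  classical
  have hΩ := card_pos_real (Ω := Ω)
  rw [entropy_sub_entropy]
  unfold condEntropy
  set L : α → β → ℝ := fun a b => Real.logb 2 (unifProb (fun ω => X ω = a ∧ Y ω = b) /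
    unifProb (fun ω => Y ω = b)) with hL
  have h1 : ∀ a b, unifProb (fun ω => X ω = a ∧ Y ω = b) * L a b =
      ∑ ω, if X ω = a ∧ Y ω = b then L a b / Fintype.card Ω else 0 := by
    intro a b
    rw [unifProb_eq_card, ← Finset.sum_filter, Finset.sum_const, nsmul_eq_mul]
    ring
  have h2 : ∑ a, ∑ b, unifProb (fun ω => X ω = a ∧ Y ω = b) * L a b =
      ∑ ω, L (X ω) (Y ω) / Fintype.card Ω := by
    simp_rw [h1]
    calc _ = ∑ ω, ∑ a, ∑ b, (if X ω = a ∧ Y ω = b then L a b / Fintype.card Ω else 0) := by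
          rw [Finset.sum_comm (s := (Finset.univ : Finset Ω))]
          exact Finset.sum_congr rfl fun a _ => Finset.sum_comm
      _ = _ := by
          refine Finset.sum_congr rfl fun ω _ => ?_
          simp_rw [ite_and]
          simp
  rw [h2, ← Finset.sum_div, ← neg_div, ← Finset.sum_neg_distrib]
  congr 1
  refine Finset.sum_congr rfl fun ω _ => ?_
  simp only [hL]
  rw [← Real.logb_inv, inv_div, unifProb_eq_card, unifProb_eq_card, div_div_div_cancel_right₀ hΩ.ne']
  simp [fiberCard, Prod.ext_iff]

lemma condEntropy_nonneg [Nonempty Ω] [Fintype α] [Fintype β] (X : Ω → α) (Y : Ω → β) :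
    0 ≤ condEntropy X Y := by
  rw [condEntropy_eq, sub_nonneg]
  exact entropy_le_of_factorsThrough fun a b hab => (Prod.ext_iff.1 hab).2

lemma condEntropy_le_entropy [Nonempty Ω] [Fintype α] [Fintype β] (X : Ω → α) (Y : Ω → β) :
    condEntropy X Y ≤ entropy X := by
  rw [condEntropy_eq, sub_le_iff_le_add]
  exact entropy_le_add fun a b hab => hab

end Entropy

/-! ### Entropy of sets of independent uniform bits -/

section Bits

variable {ι : Type}

/-- The restriction of a family of bits to the positions in `A`. -/
def bits (A : Finset ι) (F : ι → Bool) (b : {b // b ∈ A}) : Bool := F b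

lemma bits_eq_iff {A : Finset ι} {F F' : ι → Bool} : bits A F = bits A F' ↔ ∀ b ∈ A, F b = F' b := by
  simp [funext_iff, bits]

lemma bits_factorsThrough {A A' : Finset ι} (h : A ⊆ A') :
    (bits A).FactorsThrough (bits A') :=
  fun _ _ hF => bits_eq_iff.2 fun b hb => bits_eq_iff.1 hF b (h hb)

variable [Fintype ι] [DecidableEq ι]

/-- The cardinality bound holds for `A` and for its complement, and the two bounds add up to the
entropy of the whole family, so neither can be strict. -/
lemma entropy_bits (A : Finset ι) : entropy (bits A) = A.card := by
  have hle : ∀ A : Finset ι, entropy (bits A) ≤ A.card := by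
    intro A
    refine (entropy_le_logb_card _).trans (le_of_eq ?_)
    simp [Real.logb_pow]
  refine le_antisymm (hle A) ?_
  have h1 : entropy (id : (ι → Bool) → ι → Bool) ≤ entropy (bits A) + entropy (bits Aᶜ) := by
    refine entropy_le_add fun F F' h => funext fun b => ?_
    simp only [Prod.mk.injEq, bits_eq_iff] at h
    by_cases hb : b ∈ A
    · exact h.1 b hb
    · exact h.2 b (by simpa using hb)
  have h2 : entropy (id : (ι → Bool) → ι → Bool) = Fintype.card ι := by
    have : ∀ F, fiberCard (id : (ι → Bool) → ι → Bool) F = 1 := fun F => by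
      simp [fiberCard, Finset.filter_eq']
    simp only [entropy, this]
    simp [Real.logb_pow]
  have h3 := hle Aᶜ
  have h4 : ((Aᶜ.card : ℕ) : ℝ) = Fintype.card ι - A.card := by
    rw [Finset.card_compl, Nat.cast_sub (Finset.card_le_univ A)]
  linarith

end Bits

/-! ### Han's inequality -/

section Han

variable {H : ℕ}

/-- Add the elements of `Q` in increasing order: when `a` is added, the part of `Q` already present
lies in the initial segment below `a`, where the increment is no larger. -/
lemma sum_initial_le_of_submodular (f : Finset (Fin H) → ℝ)
    (hf : ∀ S T a, S ⊆ T → a ∉ T → f (insert a T) - f T ≤ f (insert a S) - f S)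
    (Q : Finset (Fin H)) :
    ∑ h ∈ Q, (f (insert h (Finset.Iio h)) - f (Finset.Iio h)) ≤ f Q - f ∅ := by
  induction Q using Finset.induction_on_max with
  | empty => simp
  | insert a s hs ih =>
    have ha : a ∉ s := fun h => lt_irrefl _ (hs a h)
    rw [Finset.sum_insert ha]
    have := hf s (Finset.Iio a) a (fun x hx => Finset.mem_Iio.2 (hs x hx)) (by simp)
    linarith

lemma sum_initial_eq (f : Finset (Fin H) → ℝ) :
    ∑ h : Fin H, (f (insert h (Finset.Iio h)) - f (Finset.Iio h)) = f Finset.univ - f ∅ := by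
  let g : ℕ → ℝ := fun n => f (Finset.univ.filter fun h : Fin H => h.val < n)
  have h1 : ∀ h : Fin H, f (insert h (Finset.Iio h)) - f (Finset.Iio h) = g (h + 1) - g h := by
    intro h
    have e1 : insert h (Finset.Iio h) = Finset.univ.filter fun h' : Fin H => h'.val < h + 1 := by
      ext x
      simp only [Finset.mem_insert, Finset.mem_Iio, Finset.mem_filter, Finset.mem_univ, true_and,
        Fin.lt_def, Fin.ext_iff]
      omega
    have e2 : Finset.Iio h = Finset.univ.filter fun h' : Fin H => h'.val < h := by
      ext x
      simp
    rw [e1, e2]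
  rw [Finset.sum_congr rfl fun h _ => h1 h,
    Fin.sum_univ_eq_sum_range (fun n => g (n + 1) - g n), Finset.sum_range_sub]
  simp [g]

lemma card_filter_mem_card_eq {b : ℕ} (hb : 1 ≤ b) (h : Fin H) :
    (Finset.univ.filter fun Q : Finset (Fin H) => Q.card = b ∧ h ∈ Q).card =
      (H - 1).choose (b - 1) := by
  have e : (Finset.univ.filter fun Q : Finset (Fin H) => Q.card = b ∧ h ∈ Q) =
      ((Finset.univ.erase h).powersetCard (b - 1)).image (insert h) := by
    ext Q
    simp only [Finset.mem_filter, Finset.mem_univ, true_and, Finset.mem_image,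
      Finset.mem_powersetCard]
    constructor
    · rintro ⟨h1, h2⟩
      exact ⟨Q.erase h, ⟨Finset.erase_subset_erase _ (Finset.subset_univ _),
        by rw [Finset.card_erase_of_mem h2, h1]⟩, Finset.insert_erase h2⟩
    · rintro ⟨Q', ⟨h1, h2⟩, rfl⟩
      have : h ∉ Q' := fun hh => by simpa using h1 hh
      rw [Finset.card_insert_of_notMem this]
      exact ⟨by omega, Finset.mem_insert_self _ _⟩
  rw [e, Finset.card_image_of_injOn, Finset.card_powersetCard, Finset.card_erase_of_mem
    (Finset.mem_univ _), Finset.card_univ, Fintype.card_fin]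
  intro A hA B hB hAB
  simp only [Finset.mem_coe, Finset.mem_powersetCard] at hA hB
  have hA' : h ∉ A := fun hh => by simpa using hA.1 hh
  have hB' : h ∉ B := fun hh => by simpa using hB.1 hh
  rw [← Finset.erase_insert hA', ← Finset.erase_insert hB']
  exact congrArg (fun s => Finset.erase s h) hAB

/-- Han's inequality for submodular functions. -/
lemma han_inequality (f : Finset (Fin H) → ℝ)
    (hf : ∀ S T a, S ⊆ T → a ∉ T → f (insert a T) - f T ≤ f (insert a S) - f S)
    {b : ℕ} (hb : 1 ≤ b) :
    ((H - 1).choose (b - 1) : ℝ) * (f Finset.univ - f ∅) ≤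
      ∑ Q ∈ Finset.univ.filter (fun Q : Finset (Fin H) => Q.card = b), (f Q - f ∅) := by
  -- Each relay lies in the same number of sets of size `b`, so summing the bounds over `Q` counts
  -- every increment of the full chain equally often.
  refine le_trans (le_of_eq ?_)
    (Finset.sum_le_sum fun Q _ => sum_initial_le_of_submodular f hf Q)
  rw [← sum_initial_eq, Finset.mul_sum]
  set g : Fin H → ℝ := fun h => f (insert h (Finset.Iio h)) - f (Finset.Iio h)
  calc ∑ h, ((H - 1).choose (b - 1) : ℝ) * g h
      = ∑ h, ∑ Q ∈ Finset.univ.filter (fun Q : Finset (Fin H) => Q.card = b),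
          if h ∈ Q then g h else 0 := by
        refine Finset.sum_congr rfl fun h _ => ?_
        rw [← Finset.sum_filter, Finset.sum_const, nsmul_eq_mul, Finset.filter_filter,
          card_filter_mem_card_eq hb h]
    _ = ∑ Q ∈ Finset.univ.filter (fun Q : Finset (Fin H) => Q.card = b), ∑ h,
          if h ∈ Q then g h else 0 := Finset.sum_comm
    _ = _ := by
        refine Finset.sum_congr rfl fun Q _ => ?_
        simp

end Han

/-! ### Averages over demand vectors with distinct entries -/

section Average

variable {H r N : ℕ}

/-- The demand vectors with distinct entries. -/
abbrev injDemands (H r N : ℕ) : Finset (Demand H r N) :=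
  Finset.univ.filter fun d : Demand H r N => Function.Injective d

lemma card_user : Fintype.card (User H r) = H.choose r := by
  rw [Fintype.card_finset_len, Fintype.card_fin]

lemma card_injDemands : (injDemands H r N).card = N.descFactorial (H.choose r) := by
  rw [← Fintype.card_subtype, Fintype.card_congr (Equiv.subtypeInjectiveEquivEmbedding _ _),
    Fintype.card_embedding_eq, card_user, Fintype.card_fin]

/-- Cyclic relabelling of the files preserves distinctness of demands, so the file demanded by `k`
is uniformly distributed. -/
lemma sum_injDemands (f : Fin N → ℝ) (k : User H r) :
    (N : ℝ) * ∑ d ∈ injDemands H r N, f (d k) =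
      N.descFactorial (H.choose r) * ∑ i, f i := by
  rcases Nat.eq_zero_or_pos N with rfl | hN
  · simp
  have : NeZero N := ⟨hN.ne'⟩
  have h1 : ∀ c : Fin N, ∑ d ∈ injDemands H r N, f (d k) = ∑ d ∈ injDemands H r N, f (c + d k) := by
    intro c
    symm
    refine Finset.sum_equiv ((Equiv.refl (User H r)).arrowCongr (Equiv.addLeft c)) (fun d => ?_) (fun d _ => ?_)
    · simp only [Finset.mem_filter, Finset.mem_univ, true_and]
      exact ((Equiv.addLeft c).injective.of_comp_iff d).symm
    · rfl
  calc (N : ℝ) * ∑ d ∈ injDemands H r N, f (d k)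
      = ∑ _c : Fin N, ∑ d ∈ injDemands H r N, f (d k) := by simp
    _ = ∑ c : Fin N, ∑ d ∈ injDemands H r N, f (c + d k) :=
        Finset.sum_congr rfl fun c _ => h1 c
    _ = ∑ d ∈ injDemands H r N, ∑ c : Fin N, f (c + d k) := Finset.sum_comm
    _ = ∑ _d ∈ injDemands H r N, ∑ i, f i := by
        refine Finset.sum_congr rfl fun d _ => ?_
        exact Equiv.sum_comp (Equiv.addRight (d k)) f
    _ = _ := by rw [Finset.sum_const, card_injDemands, nsmul_eq_mul]

end Average

/-! ### Replacing some of the bits by constants -/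

section Patch

variable {ι : Type} [DecidableEq ι]

/-- The bits of `F` at the positions in `T`, and those of `u` elsewhere. -/
def patch (T : Finset ι) (u F : ι → Bool) (b : ι) : Bool := if b ∈ T then F b else u b

lemma patch_of_mem {T : Finset ι} {u F : ι → Bool} {b : ι} (hb : b ∈ T) : patch T u F b = F b :=
  if_pos hb

lemma patch_of_notMem {T : Finset ι} {u F : ι → Bool} {b : ι} (hb : b ∉ T) :
    patch T u F b = u b :=
  if_neg hb

lemma patch_eq_patch_iff {T : Finset ι} {u F F' : ι → Bool} :
    patch T u F = patch T u F' ↔ ∀ b ∈ T, F b = F' b := by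
  constructor
  · intro h b hb
    have := congrFun h b
    rwa [patch_of_mem hb, patch_of_mem hb] at this
  · intro h
    funext b
    by_cases hb : b ∈ T
    · rw [patch_of_mem hb, patch_of_mem hb, h b hb]
    · rw [patch_of_notMem hb, patch_of_notMem hb]

variable [Fintype ι]

/-- Exchanging `u` and `F` outside `T` is an involution on pairs, so a patched family with both
parts uniform is again uniform. -/
lemma sum_patch (T : Finset ι) (f : (ι → Bool) → ℝ) :
    ∑ u : ι → Bool, ∑ F : ι → Bool, f (patch T u F) =
      Fintype.card (ι → Bool) * ∑ F, f F := by
  let e : (ι → Bool) × (ι → Bool) ≃ (ι → Bool) × (ι → Bool) :=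
    { toFun := fun p => (patch T p.2 p.1, patch T p.1 p.2)
      invFun := fun p => (patch T p.2 p.1, patch T p.1 p.2)
      left_inv := fun p => by
        ext b <;> by_cases hb : b ∈ T <;> simp [patch, hb]
      right_inv := fun p => by
        ext b <;> by_cases hb : b ∈ T <;> simp [patch, hb] }
  rw [← Fintype.sum_prod_type' (f := fun u F => f (patch T u F))]
  rw [Fintype.sum_equiv e (fun p => f (patch T p.1 p.2)) (fun p => f p.2) (fun p => rfl),
    Fintype.sum_prod_type]
  simp only [Finset.sum_const, Finset.card_univ, nsmul_eq_mul]

/-- Derandomization: the average over `u` of the sum of the patched probabilities equals the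
original sum, so one `u` serves all events at once. -/
lemma exists_patch_unifProb_le {κ : Type} [Fintype κ] (T : Finset ι)
    (E : κ → (ι → Bool) → Prop) :
    ∃ u : ι → Bool, ∀ k, unifProb (fun F => E k (patch T u F)) ≤ ∑ k', unifProb (E k') := by
  classical
  obtain ⟨u, hu⟩ : ∃ u : ι → Bool,
      ∑ k, unifProb (fun F => E k (patch T u F)) ≤ ∑ k, unifProb (E k) := by
    obtain ⟨u, -, hu⟩ := Finset.exists_le_of_sum_le (s := (Finset.univ : Finset (ι → Bool)))
      (f := fun u => ∑ k, unifProb (fun F => E k (patch T u F)))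
      (g := fun _ => ∑ k, unifProb (E k)) Finset.univ_nonempty (by
        rw [Finset.sum_comm, Finset.sum_const, nsmul_eq_mul, Finset.card_univ, Finset.mul_sum]
        refine Finset.sum_le_sum fun k _ => le_of_eq ?_
        have h := sum_patch T fun F => if E k F then (1 : ℝ) else 0
        simp only [Finset.sum_boole] at h
        simp only [unifProb_eq_card]
        rw [← Finset.sum_div, h, mul_div_assoc])
    exact ⟨u, hu⟩
  exact ⟨u, fun k => (Finset.single_le_sum
    (f := fun k => unifProb (fun F => E k (patch T u F))) (fun _ _ => unifProb_nonneg _)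
    (Finset.mem_univ k)).trans hu⟩

end Patch

/-! ### Acyclic sets of sub-files -/

section Acyclic

variable {H r N : ℕ}

lemma mem_requested {d : Demand H r N} {s : Fin N × Finset (User H r)} :
    s ∈ requested d ↔ ∃ k, s.1 = d k ∧ k ∉ s.2 := by
  simp [requested]

lemma mem_acyclicSet {d : Demand H r N} {S' : Finset (User H r)} {v : List (User H r)}
    {s : Fin N × Finset (User H r)} :
    s ∈ acyclicSet d S' v ↔ ∃ l₁ k l₂, v = l₁ ++ k :: l₂ ∧ s.1 = d k ∧
      s.2 ⊆ S' \ (l₁ ++ [k]).toFinset := by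
  simp only [acyclicSet, Finset.mem_biUnion, Finset.mem_univ, true_and, Finset.mem_image,
    Finset.mem_powerset]
  constructor
  · rintro ⟨i, W, hW, rfl⟩
    refine ⟨v.take i, v.get i, v.drop (i + 1), ?_, rfl, ?_⟩
    · simp
    · simpa using hW
  · rintro ⟨l₁, k, l₂, rfl, h1, h2⟩
    refine ⟨⟨l₁.length, by simp⟩, s.2, ?_, ?_⟩
    · have : (l₁ ++ k :: l₂).take (l₁.length + 1) = l₁ ++ [k] := by
        simp [List.take_append]
      simpa only [this] using h2
    · ext1 <;> simp [h1]

lemma acyclicSet_subset_requested (d : Demand H r N) (S' : Finset (User H r))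
    (v : List (User H r)) : acyclicSet d S' v ⊆ requested d := by
  intro s hs
  obtain ⟨l₁, k, l₂, -, h1, h2⟩ := mem_acyclicSet.1 hs
  exact mem_requested.2 ⟨k, h1, fun hk => by simpa using h2 hk⟩

/-- This is the acyclicity: a sub-file charged to a user avoids the caches of that user and of all
users before it, so if `k` caches it, it was charged strictly before `k`. -/
lemma exists_earlier_of_mem_acyclicSet {d : Demand H r N} {S' : Finset (User H r)}
    {l₁ l₂ : List (User H r)} {k : User H r} {s : Fin N × Finset (User H r)}
    (hs : s ∈ acyclicSet d S' (l₁ ++ k :: l₂)) (hk : k ∈ s.2) : ∃ k' ∈ l₁, s.1 = d k' := by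
  obtain ⟨m₁, k', m₂, h, h1, h2⟩ := mem_acyclicSet.1 hs
  have hk' : k ∉ m₁ ∧ k ≠ k' := by simpa [and_comm] using (Finset.mem_sdiff.1 (h2 hk)).2
  refine ⟨k', ?_, h1⟩
  rcases List.append_eq_append_iff.1 h with ⟨c, hc1, hc2⟩ | ⟨c, hc1, hc2⟩
  · cases c with
    | nil => simp at hc2; exact absurd hc2.1 hk'.2
    | cons a c =>
      simp only [List.cons_append, List.cons.injEq] at hc2
      exact absurd (by simp [hc1, hc2.1]) hk'.1
  · cases c with
    | nil => simp at hc2; exact absurd hc2.1.symm hk'.2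
    | cons a c =>
      simp only [List.cons_append, List.cons.injEq] at hc2
      simp [hc1, hc2.1]

/-- Deleting users from the list only shortens the prefix that a sub-file has to avoid. -/
lemma mem_acyclicSet_subvector {d : Demand H r N} {A S : Finset (User H r)}
    {p : List (User H r)} {s : Fin N × Finset (User H r)} {k : User H r} {l₁ l₂ : List (User H r)}
    (hp : p = l₁ ++ k :: l₂) (h1 : s.1 = d k) (h2 : s.2 ⊆ S \ (l₁ ++ [k]).toFinset)
    (hk : k ∈ A) (hs : s.2 ⊆ A) : s ∈ acyclicSet d A (subvector A p) := by
  subst hp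
  refine mem_acyclicSet.2 ⟨l₁.filter (fun k => k ∈ A), k, l₂.filter (fun k => k ∈ A), ?_, h1, ?_⟩
  · simp [subvector, List.filter_append, hk]
  · intro j hj
    have := h2 hj
    simp only [Finset.mem_sdiff, List.toFinset_append, Finset.mem_union, List.mem_toFinset,
      List.mem_filter] at this ⊢
    exact ⟨hs hj, fun h => this.2 (h.imp (fun h => h.1) id)⟩

/-- The indices `(i, W)` with `W` disjoint from the first `i` entries of `p`. -/
def acyclicIndex (p : List (User H r)) : Finset (Σ _ : Fin p.length, Finset (User H r)) :=
  Finset.univ.sigma fun i => (Finset.univ \ (p.take (i + 1)).toFinset).powerset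

/-- The index of the sub-file requested by the `i`-th user in `p`. -/
def subfileIndex (d : Demand H r N) (p : List (User H r))
    (t : Σ _ : Fin p.length, Finset (User H r)) : Fin N × Finset (User H r) :=
  (d (p.get t.1), t.2)

lemma subfileIndex_injective {d : Demand H r N} (hd : Function.Injective d)
    {p : List (User H r)} (hp : p.Nodup) : Function.Injective (subfileIndex d p) := by
  rintro ⟨i, W⟩ ⟨j, W'⟩ h
  simp only [subfileIndex, Prod.mk.injEq] at h
  obtain ⟨h1, rfl⟩ := h
  have := List.nodup_iff_injective_get.1 hp (hd h1)
  rw [this]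

lemma image_subfileIndex (d : Demand H r N) (p : List (User H r)) :
    (acyclicIndex p).image (subfileIndex d p) = acyclicSet d Finset.univ p := by
  ext s
  simp only [acyclicIndex, subfileIndex, acyclicSet, Finset.mem_image, Finset.mem_sigma,
    Finset.mem_univ, true_and, Finset.mem_biUnion, Sigma.exists]

end Acyclic

/-! ### Sub-files of a scheme -/

namespace Scheme

variable {H r N : ℕ} {M : ℝ} (σ : Scheme H r N M)

lemma B_pos_real : (0 : ℝ) < σ.B := by exact_mod_cast σ.B_pos

lemma one_le_B : (1 : ℝ) ≤ σ.B := by exact_mod_cast σ.B_pos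

/-- The users that cache the bit at position `b`. -/
def owners (b : Fin N × Fin σ.B) : Finset (User H r) :=
  Finset.univ.filter fun k => b ∈ σ.cache k

lemma mem_owners {b : Fin N × Fin σ.B} {k : User H r} : k ∈ σ.owners b ↔ b ∈ σ.cache k := by
  simp [owners]

lemma mem_subfile {i : Fin N} {W : Finset (User H r)} {b : Fin N × Fin σ.B} :
    b ∈ σ.subfile i W ↔ b.1 = i ∧ σ.owners b = W := by
  simp [subfile, Finset.ext_iff, mem_owners]

/-- Every bit lies in exactly one sub-file, so identities between sets of bits reduce to
propositional ones about indices. -/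
lemma mem_bitsOf {S : Finset (Fin N × Finset (User H r))} {b : Fin N × Fin σ.B} :
    b ∈ σ.bitsOf S ↔ (b.1, σ.owners b) ∈ S := by
  simp only [bitsOf, Finset.mem_biUnion, mem_subfile]
  constructor
  · rintro ⟨s, hs, h1, h2⟩
    rwa [h1, h2]
  · exact fun h => ⟨_, h, rfl, rfl⟩

lemma mem_bitsOf_requested {d : Demand H r N} {b : Fin N × Fin σ.B} :
    b ∈ σ.bitsOf (requested d) ↔ ∃ k, b.1 = d k ∧ b ∉ σ.cache k := by
  simp [mem_bitsOf, mem_requested, mem_owners]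

lemma card_bitsOf (S : Finset (Fin N × Finset (User H r))) :
    (σ.bitsOf S).card = ∑ s ∈ S, (σ.subfile s.1 s.2).card := by
  refine Finset.card_biUnion fun s _ t _ hst => Finset.disjoint_left.2 fun b hs ht => hst ?_
  rw [mem_subfile] at hs ht
  exact Prod.ext (hs.1.symm.trans ht.1) (hs.2.symm.trans ht.2)

lemma card_bitsOf_image {d : Demand H r N} (hd : Function.Injective d)
    {p : List (User H r)} (hp : p.Nodup) (P : Finset (Σ _ : Fin p.length, Finset (User H r))) :
    ((σ.bitsOf (P.image (subfileIndex d p))).card : ℝ) =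
      ∑ t ∈ P, ((σ.subfile (d (p.get t.1)) t.2).card : ℝ) := by
  rw [card_bitsOf, Finset.sum_image ((subfileIndex_injective hd hp).injOn)]
  push_cast
  rfl

lemma sum_card_subfile (hN : 0 < N) (W : Finset (User H r)) :
    ∑ i, ((σ.subfile i W).card : ℝ) = N * σ.B * σ.x W := by
  have h1 := σ.B_pos_real
  have h2 : (0 : ℝ) < N := by exact_mod_cast hN
  rw [x, mul_div_cancel₀ _ (by positivity)]

lemma sum_card_subfile_eq (P : Finset (User H r) → Prop) [DecidablePred P] :
    ∑ W ∈ Finset.univ.filter P, ∑ i, (σ.subfile i W).card =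
      (Finset.univ.filter fun b => P (σ.owners b)).card := by
  rw [Finset.card_eq_sum_card_fiberwise (f := fun b => (σ.owners b))
    (t := Finset.univ.filter P) (fun b hb => by simpa using hb)]
  refine Finset.sum_congr rfl fun W hW => ?_
  rw [Finset.card_eq_sum_card_fiberwise (f := fun b => b.1) (t := Finset.univ)
    (fun _ _ => by simp)]
  refine Finset.sum_congr rfl fun i _ => congrArg _ ?_
  ext b
  simp only [Finset.mem_filter, Finset.mem_univ, true_and] at hW ⊢
  rw [mem_subfile]
  constructor
  · rintro ⟨rfl, rfl⟩
    exact ⟨⟨hW, rfl⟩, rfl⟩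
  · rintro ⟨⟨-, h⟩, h'⟩
    exact ⟨h', h⟩

lemma sum_x_filter (P : Finset (User H r) → Prop) [DecidablePred P] :
    ∑ W ∈ Finset.univ.filter P, σ.x W =
      ((Finset.univ.filter fun b => P (σ.owners b)).card : ℝ) / (N * σ.B) := by
  rw [← sum_card_subfile_eq]
  simp only [x]
  rw [← Finset.sum_div]
  push_cast
  rfl

lemma sum_x (hN : 0 < N) : ∑ W, σ.x W = 1 := by
  have h := σ.sum_x_filter fun _ => True
  have h1 := σ.B_pos_real
  have h2 : (0 : ℝ) < N := by exact_mod_cast hN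
  simp only [Finset.filter_true] at h
  rw [h]
  simp only [Finset.card_univ, Fintype.card_prod, Fintype.card_fin]
  push_cast
  exact div_self (by positivity)

lemma sum_x_mem_le (k : User H r) :
    ∑ W ∈ Finset.univ.filter (fun W : Finset (User H r) => k ∈ W), σ.x W ≤ M / N := by
  have h1 := σ.B_pos_real
  rw [sum_x_filter]
  simp only [mem_owners]
  rw [show (Finset.univ.filter fun b => b ∈ σ.cache k) = σ.cache k by ext; simp]
  calc ((σ.cache k).card : ℝ) / (N * σ.B) ≤ M * σ.B / (N * σ.B) :=
        div_le_div_of_nonneg_right (σ.cache_card k) (by positivity)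
    _ = M / N := mul_div_mul_right _ _ h1.ne'

lemma x_nonneg (W : Finset (User H r)) : 0 ≤ σ.x W := by
  unfold x; positivity

lemma x_le_one (hN : 0 < N) (W : Finset (User H r)) : σ.x W ≤ 1 := by
  rw [← σ.sum_x hN]
  exact Finset.single_le_sum (fun W _ => σ.x_nonneg W) (Finset.mem_univ W)

/-! ### Load and entropy of the messages -/

lemma load_nonneg : 0 ≤ σ.load := by
  unfold load; positivity

lemma relayBits_le (d : Demand H r N) (h : Fin H) : (σ.relayBits d h : ℝ) ≤ σ.load * σ.B := by
  rw [load, div_mul_cancel₀ _ σ.B_pos_real.ne']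
  exact_mod_cast (Finset.le_sup (f := fun dh : Demand H r N × Fin H => σ.relayBits dh.1 dh.2)
    (Finset.mem_univ (d, h))).trans (le_max_left _ _)

lemma entropy_msgs_le (d : Demand H r N) (Q : Finset (Fin H)) :
    entropy (σ.msgs d Q) ≤ Q.card * σ.load * σ.B := by
  refine (entropy_le_logb_card _).trans ?_
  have : ((Fintype.card (∀ h : {h // h ∈ Q}, Fin (σ.relayBits d h.1) → Bool) : ℕ) : ℝ) =
      2 ^ (∑ h ∈ Q, σ.relayBits d h) := by
    rw [Fintype.card_pi]
    simp only [Fintype.card_pi, Fintype.card_bool, Finset.prod_const, Finset.card_univ,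
      Fintype.card_fin, Finset.prod_pow_eq_pow_sum]
    push_cast
    congr 1
    exact Finset.sum_coe_sort Q (fun h => σ.relayBits d h)
  rw [this, Real.logb_pow, Real.logb_self_eq_one one_lt_two, mul_one]
  push_cast
  refine (Finset.sum_le_sum fun h _ => σ.relayBits_le d h).trans (le_of_eq ?_)
  rw [Finset.sum_const, nsmul_eq_mul, mul_assoc]

lemma entropyGivenCompl_eq (d : Demand H r N) (Q : Finset (Fin H))
    (S : Finset (Fin N × Finset (User H r))) :
    σ.entropyGivenCompl d Q S =
      entropy (fun F => (σ.msgs d Q F, bits (σ.bitsOf (requested d \ S)) F)) -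
        (σ.bitsOf (requested d \ S)).card := by
  rw [← entropy_bits, entropyGivenCompl, condEntropy_eq]
  rfl

lemma entropyGivenCompl_le (d : Demand H r N) (Q : Finset (Fin H))
    (S : Finset (Fin N × Finset (User H r))) :
    σ.entropyGivenCompl d Q S ≤ Q.card * σ.load * σ.B :=
  (condEntropy_le_entropy _ _).trans (σ.entropy_msgs_le d Q)

lemma descFactorial_pos_real (hN : H.choose r ≤ N) : (0 : ℝ) < N.descFactorial (H.choose r) := by
  exact_mod_cast Nat.descFactorial_pos.2 hN

lemma yPerm_nonneg (Q : Finset (Fin H)) (p : List (User H r)) : 0 ≤ σ.yPerm Q p := by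
  unfold yPerm
  exact div_nonneg (Finset.sum_nonneg fun d _ => condEntropy_nonneg _ _) (by positivity)

lemma yPerm_le (hN : H.choose r ≤ N) (Q : Finset (Fin H)) (p : List (User H r)) :
    σ.yPerm Q p ≤ Q.card * σ.load := by
  have h1 := σ.B_pos_real
  have h2 := descFactorial_pos_real hN
  unfold yPerm
  rw [div_le_iff₀ (by positivity)]
  refine (Finset.sum_le_sum fun d _ => σ.entropyGivenCompl_le d Q _).trans (le_of_eq ?_)
  rw [Finset.sum_const, card_injDemands, nsmul_eq_mul]
  ring

lemma yPerm_le_y (hN : H.choose r ≤ N) (Q : Finset (Fin H)) {p : List (User H r)}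
    (hp : IsPerm p Finset.univ) : σ.yPerm Q p ≤ σ.y Q :=
  le_ciSup (f := fun p : {p : List (User H r) // IsPerm p Finset.univ} => σ.yPerm Q p.1)
    ⟨Q.card * σ.load, by rintro _ ⟨p, rfl⟩; exact σ.yPerm_le hN Q p.1⟩ ⟨p, hp⟩

lemma isPerm_toList_univ : IsPerm (Finset.univ : Finset (User H r)).toList Finset.univ :=
  ⟨Finset.nodup_toList _, Finset.toList_toFinset _⟩

lemma y_le_of_forall {Q : Finset (Fin H)} {a : ℝ}
    (h : ∀ p : List (User H r), IsPerm p Finset.univ → σ.yPerm Q p ≤ a) : σ.y Q ≤ a :=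
  have : Nonempty {p : List (User H r) // IsPerm p Finset.univ} := ⟨⟨_, isPerm_toList_univ⟩⟩
  ciSup_le fun p => h p.1 p.2

lemma y_nonneg (hN : H.choose r ≤ N) (Q : Finset (Fin H)) : 0 ≤ σ.y Q :=
  (σ.yPerm_nonneg Q _).trans (σ.yPerm_le_y hN Q isPerm_toList_univ)

lemma y_le (hN : H.choose r ≤ N) (Q : Finset (Fin H)) : σ.y Q ≤ Q.card * σ.load :=
  σ.y_le_of_forall fun p _ => σ.yPerm_le hN Q p

lemma sum_injDemands_card_subfile (hN : 0 < N) (k : User H r) (W : Finset (User H r)) :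
    ∑ d ∈ injDemands H r N, ((σ.subfile (d k) W).card : ℝ) =
      σ.B * N.descFactorial (H.choose r) * σ.x W := by
  have h := sum_injDemands (fun i => ((σ.subfile i W).card : ℝ)) k
  rw [sum_card_subfile σ hN] at h
  have h2 : (N : ℝ) ≠ 0 := by exact_mod_cast hN.ne'
  refine mul_left_cancel₀ h2 (h.trans ?_)
  ring

/-! ### Decoding -/

lemma toRelay_patch (hσ : σ.OnlyRequested) (d : Demand H r N) (h : Fin H) (u F : Library N σ.B) :
    σ.toRelay d h (patch (σ.bitsOf (requested d)) u F) = σ.toRelay d h F :=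
  hσ d h _ _ fun _ hb => patch_of_mem hb

/-- The bound, per bit of a file, on the equivocation of a file decoded with error probability at
most `e`. -/
def equivocation (δ e : ℝ) : ℝ := -Real.logb 2 (1 - δ) + e * (1 - Real.logb 2 δ)

/-- Fano's inequality for user `k`. The set `C` need not contain the cached bits that nobody
requests. These are frozen to constants, which leaves the messages unchanged because they depend on
requested bits only. -/
lemma entropy_decode_le (hσ : σ.OnlyRequested) {d : Demand H r N} {k : User H r}
    {Q : Finset (Fin H)} (hk : k.1 ⊆ Q) {C : Finset (Fin N × Fin σ.B)}
    (hC : ∀ b ∈ σ.cache k, b ∈ σ.bitsOf (requested d) → b ∈ C)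
    {δ e : ℝ} (h0 : 0 < δ) (h1 : δ < 1) (he : σ.errorProb d k ≤ e) :
    entropy (fun F => (σ.msgs d Q F,
      bits (C ∪ (σ.bitsOf (requested d)).filter fun b => b.1 = d k) F)) ≤
      entropy (fun F => (σ.msgs d Q F, bits C F)) + σ.B * equivocation δ e := by
  set T := σ.bitsOf (requested d)
  obtain ⟨u, hu⟩ := exists_patch_unifProb_le T (κ := Unit)
    (fun _ (F : Library N σ.B) => σ.output d k F ≠ fun j => F (d k, j))
  have hu' := (hu ()).trans (le_of_eq (Fintype.sum_unique _))
  have hY' : (fun F : Library N σ.B => σ.output d k (patch T u F)).FactorsThrough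
      (fun F => (σ.msgs d Q F, bits C F)) := by
    intro F F' hF
    simp only [Prod.mk.injEq, bits_eq_iff] at hF
    simp only [output, T, toRelay_patch σ hσ]
    congr 1
    · funext b
      by_cases hb : b.1 ∈ σ.bitsOf (requested d)
      · rw [patch_of_mem hb, patch_of_mem hb, hF.2 _ (hC _ b.2 hb)]
      · rw [patch_of_notMem hb, patch_of_notMem hb]
    · funext h
      exact congrArg _ (congrFun hF.1 ⟨h.1, hk h.2⟩)
  have hfano := entropy_fano (fun F : Library N σ.B => fun j => patch T u F (d k, j)) _ _ hY' h0 h1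
  have hstep : entropy (fun F => (σ.msgs d Q F, bits (C ∪ T.filter fun b => b.1 = d k) F)) ≤
      entropy (fun F => ((fun j => patch T u F (d k, j)), (σ.msgs d Q F, bits C F))) := by
    refine entropy_le_of_factorsThrough fun F F' hF => ?_
    simp only [Prod.mk.injEq, bits_eq_iff] at hF ⊢
    refine ⟨hF.2.1, fun b hb => ?_⟩
    rcases Finset.mem_union.1 hb with hb | hb
    · exact hF.2.2 b hb
    · obtain ⟨hbT, hbk⟩ := Finset.mem_filter.1 hb
      have h := congrFun hF.1 b.2
      rw [← hbk] at h
      rwa [patch_of_mem hbT, patch_of_mem hbT] at h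
  have hcard : Real.logb 2 (Fintype.card (Fin σ.B → Bool)) = σ.B := by
    simp [Real.logb_pow]
  rw [hcard] at hfano
  have hδ : Real.logb 2 δ ≤ 0 := Real.logb_nonpos one_lt_two h0.le h1.le
  have hδ' : Real.logb 2 (1 - δ) ≤ 0 :=
    Real.logb_nonpos one_lt_two (by linarith) (by linarith)
  have hB := σ.one_le_B
  have he0 : 0 ≤ e := (unifProb_nonneg _).trans he
  have hmul := mul_le_mul_of_nonneg_right (hu'.trans he)
    (show 0 ≤ (σ.B : ℝ) - Real.logb 2 δ by linarith)
  -- Since B ≥ 1, the terms that do not grow with B may be multiplied by B; the loss is then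
  -- proportional to the file size.
  have hbound : -Real.logb 2 (1 - δ) + e * (σ.B - Real.logb 2 δ) ≤ σ.B * equivocation δ e := by
    unfold equivocation
    nlinarith [mul_nonneg (sub_nonneg.2 hB) (neg_nonneg.2 hδ'),
      mul_nonneg (mul_nonneg (sub_nonneg.2 hB) (neg_nonneg.2 hδ)) he0]
  linarith

/-- Successive decoding: each user's cache is covered by `C` and the files decoded before, and its
own file then joins `C`. -/
lemma entropy_decode_list_le (hσ : σ.OnlyRequested) {d : Demand H r N} {Q : Finset (Fin H)}
    {δ e : ℝ} (h0 : 0 < δ) (h1 : δ < 1) (he : ∀ k, σ.errorProb d k ≤ e)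
    {A : Finset (Fin N × Fin σ.B)} (hA : A ⊆ σ.bitsOf (requested d)) :
    ∀ (p : List (User H r)) (C : Finset (Fin N × Fin σ.B)), (∀ k ∈ p, k.1 ⊆ Q) →
      (∀ l₁ k l₂, p = l₁ ++ k :: l₂ → ∀ b ∈ σ.cache k, b ∈ σ.bitsOf (requested d) →
        b ∈ C ∨ ∃ k' ∈ l₁, b.1 = d k') →
      (∀ b ∈ A, b ∈ C ∨ ∃ k ∈ p, b.1 = d k) →
      entropy (fun F => (σ.msgs d Q F, bits A F)) ≤
        entropy (fun F => (σ.msgs d Q F, bits C F)) + p.length * (σ.B * equivocation δ e) := by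
  intro p
  induction p with
  | nil =>
    intro C _ _ hAC
    simp only [List.length_nil, Nat.cast_zero, zero_mul, add_zero]
    refine entropy_le_of_factorsThrough fun F F' hF => ?_
    simp only [Prod.mk.injEq] at hF ⊢
    exact ⟨hF.1, bits_factorsThrough (fun b hb => by simpa using hAC b hb) hF.2⟩
  | cons k p ih =>
    intro C hQ hC hAC
    have hstep := σ.entropy_decode_le hσ (hQ k (by simp)) (C := C)
      (fun b hb hbT => by simpa using hC [] k p rfl b hb hbT) h0 h1 (he k)
    have hrest := ih (C ∪ (σ.bitsOf (requested d)).filter fun b => b.1 = d k)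
      (fun k' hk' => hQ k' (by simp [hk']))
      (fun l₁ k' l₂ hp b hb hbT => by
        rcases hC (k :: l₁) k' l₂ (by rw [hp]; rfl) b hb hbT with h | ⟨j, hj, h⟩
        · exact Or.inl (Finset.mem_union_left _ h)
        · rcases List.mem_cons.1 hj with rfl | hj
          · exact Or.inl (Finset.mem_union_right _ (Finset.mem_filter.2 ⟨hbT, h⟩))
          · exact Or.inr ⟨j, hj, h⟩)
      (fun b hb => by
        rcases hAC b hb with h | ⟨j, hj, h⟩
        · exact Or.inl (Finset.mem_union_left _ h)
        · rcases List.mem_cons.1 hj with rfl | hj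
          · exact Or.inl (Finset.mem_union_right _ (Finset.mem_filter.2 ⟨hA hb, h⟩))
          · exact Or.inr ⟨j, hj, h⟩)
    push_cast [List.length_cons]
    linarith

end Scheme

/-! ### Outer bounds for a single scheme -/

namespace Scheme

variable {H r N : ℕ} {M : ℝ} (σ : Scheme H r N M)

lemma entropy_decode_acyclic_le (hσ : σ.OnlyRequested) {d : Demand H r N} {Q : Finset (Fin H)}
    {δ e : ℝ} (h0 : 0 < δ) (h1 : δ < 1) (he : ∀ k, σ.errorProb d k ≤ e)
    {p : List (User H r)} (hQ : ∀ k ∈ p, k.1 ⊆ Q) {P S₂ : Finset (Fin N × Finset (User H r))}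
    (hP : P ⊆ acyclicSet d Finset.univ p) (hS₂ : ∀ s ∈ S₂, ∀ k ∈ p, k ∉ s.2)
    {C : Finset (Fin N × Fin σ.B)} (hC : C = σ.bitsOf (requested d \ (P ∪ S₂))) :
    entropy (fun F => (σ.msgs d Q F, bits (C ∪ σ.bitsOf P) F)) ≤
      entropy (fun F => (σ.msgs d Q F, bits C F)) + p.length * (σ.B * equivocation δ e) := by
  subst hC
  refine σ.entropy_decode_list_le hσ h0 h1 he (fun b hb => ?_) p _ hQ ?_ ?_
  · rw [mem_bitsOf]
    rcases Finset.mem_union.1 hb with hb | hb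
    · exact (Finset.mem_sdiff.1 (σ.mem_bitsOf.1 hb)).1
    · exact acyclicSet_subset_requested _ _ _ (hP (σ.mem_bitsOf.1 hb))
  -- A requested bit cached by `k` but missing from `C` lies in `P` or `S₂`; the latter is
  -- impossible, and in the former case an earlier user demands its file.
  · intro l₁ k l₂ hp b hb hbT
    by_cases hbC : b ∈ σ.bitsOf (requested d \ (P ∪ S₂))
    · exact Or.inl hbC
    rw [mem_bitsOf] at hbC hbT
    have hmem : (b.1, σ.owners b) ∈ P ∪ S₂ := by
      by_contra h
      exact hbC (Finset.mem_sdiff.2 ⟨hbT, h⟩)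
    have hk : k ∈ σ.owners b := σ.mem_owners.2 hb
    rcases Finset.mem_union.1 hmem with h | h
    · have := hP h
      rw [hp] at this
      exact Or.inr (exists_earlier_of_mem_acyclicSet this hk)
    · exact absurd hk (hS₂ _ h k (by simp [hp]))
  · intro b hb
    rcases Finset.mem_union.1 hb with hb | hb
    · exact Or.inl hb
    · obtain ⟨l₁, k, l₂, hp, h, -⟩ := mem_acyclicSet.1 (hP (σ.mem_bitsOf.1 hb))
      exact Or.inr ⟨k, by simp [hp], h⟩

lemma entropy_prod_msgs_bits_ge (d : Demand H r N) (Q : Finset (Fin H))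
    (A : Finset (Fin N × Fin σ.B)) :
    (A.card : ℝ) ≤ entropy (fun F => (σ.msgs d Q F, bits A F)) := by
  rw [← entropy_bits]
  exact entropy_le_of_factorsThrough fun F F' h => (Prod.ext_iff.1 h).2

/-- Distinct demands make S₁ and S₂ disjoint, so S₂ᶜ is the disjoint union of `C` and S₁. The left
side is then H(X_Q, C, S₁) - |C|; decoding removes S₁ from the entropy, and what is left is at most
H(X_Q). -/
lemma card_bitsOf_acyclicSet_add_le (hσ : σ.OnlyRequested) {d : Demand H r N}
    (hd : Function.Injective d) {Q : Finset (Fin H)}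
    {δ e : ℝ} (h0 : 0 < δ) (h1 : δ < 1) (he : ∀ k, σ.errorProb d k ≤ e)
    {p : List (User H r)} (hp : IsPerm p (usersOf r Q)) (v : List (User H r)) :
    ((σ.bitsOf (acyclicSet d Finset.univ p)).card : ℝ) +
      σ.entropyGivenCompl d Q (acyclicSet d (Finset.univ \ usersOf r Q)
        (subvector (Finset.univ \ usersOf r Q) v)) ≤
      Q.card * σ.load * σ.B + p.length * (σ.B * equivocation δ e) := by
  have hpQ : ∀ k, k ∈ p ↔ k ∈ usersOf r Q := fun k => by rw [← hp.2, List.mem_toFinset]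
  set S₁ := acyclicSet d Finset.univ p with hS₁
  set S₂ := acyclicSet d (Finset.univ \ usersOf r Q)
    (subvector (Finset.univ \ usersOf r Q) v) with hS₂
  have hS₂' : ∀ s ∈ S₂, ∀ k ∈ p, k ∉ s.2 := by
    intro s hs k hk hks
    obtain ⟨l₁, k', l₂, -, -, h⟩ := mem_acyclicSet.1 hs
    have := h hks
    simp [(hpQ k).1 hk] at this
  have hdisj : ∀ s ∈ S₁, s ∉ S₂ := by
    intro s hs hs'
    obtain ⟨l₁, k, l₂, hk, h, -⟩ := mem_acyclicSet.1 hs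
    obtain ⟨m₁, k', m₂, hk', h', -⟩ := mem_acyclicSet.1 hs'
    have hkk := hd (h.symm.trans h')
    have h1 : k ∈ usersOf r Q := (hpQ k).1 (by simp [hk])
    have h2 : k' ∈ subvector (Finset.univ \ usersOf r Q) v := by simp [hk']
    rw [subvector, List.mem_filter] at h2
    rw [hkk] at h1
    simp [h1] at h2
  set C := σ.bitsOf (requested d \ (S₁ ∪ S₂)) with hC
  have hCu : σ.bitsOf (requested d \ S₂) = C ∪ σ.bitsOf S₁ := by
    ext b
    simp only [hC, Finset.mem_union, mem_bitsOf, Finset.mem_sdiff]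
    have hreq : (b.1, σ.owners b) ∈ S₁ → (b.1, σ.owners b) ∈ requested d :=
      fun h => acyclicSet_subset_requested _ _ _ h
    have := hdisj (b.1, σ.owners b)
    tauto
  have hcard : ((C ∪ σ.bitsOf S₁).card : ℝ) = C.card + (σ.bitsOf S₁).card := by
    rw [Finset.card_union_of_disjoint]
    · push_cast; rfl
    · rw [Finset.disjoint_left]
      intro b hb hb'
      rw [mem_bitsOf] at hb'
      rw [hC, mem_bitsOf, Finset.mem_sdiff, Finset.mem_union] at hb
      exact hb.2 (Or.inl hb')
  have hQ : ∀ k ∈ p, k.1 ⊆ Q := fun k hk => by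
    simpa [usersOf] using (hpQ k).1 hk
  have hdec := σ.entropy_decode_acyclic_le hσ h0 h1 he hQ (P := S₁) (S₂ := S₂) subset_rfl hS₂' hC
  have hadd : entropy (fun F => (σ.msgs d Q F, bits C F)) ≤
      entropy (σ.msgs d Q) + entropy (bits C) := entropy_le_add fun _ _ h => h
  rw [entropy_bits] at hadd
  have hmsg := σ.entropy_msgs_le d Q
  rw [entropyGivenCompl_eq, hCu, hcard]
  linarith

/-- Change of conditioning: enlarge the condition Sᶜ to Sᶜ ∪ Pᶜ, which lowers the entropy, then note
that this union exceeds Pᶜ by at most the bits of P \ S. -/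
lemma entropyGivenCompl_ge {d : Demand H r N} {Q : Finset (Fin H)}
    (P S : Finset (Fin N × Finset (User H r))) :
    entropy (fun F => (σ.msgs d Q F, bits (σ.bitsOf (requested d \ P)) F)) -
      (σ.bitsOf (requested d \ P)).card - (σ.bitsOf (P \ S)).card ≤
      σ.entropyGivenCompl d Q S := by
  set C := σ.bitsOf (requested d \ P) with hC
  set C₁ := σ.bitsOf (requested d \ S) with hC₁
  have hsub : entropy (fun F => (σ.msgs d Q F, bits (C ∪ C₁) F)) + entropy (bits C₁) ≤
      entropy (fun F => (σ.msgs d Q F, bits C₁ F)) + entropy (bits (C ∪ C₁)) :=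
    entropy_submodular (fun F F' h => (Prod.ext_iff.1 h).2)
      (bits_factorsThrough Finset.subset_union_right)
      (fun F F' h => by
        simp only [Prod.mk.injEq] at h ⊢
        exact ⟨h.1.1, h.2⟩)
  have hmono : entropy (fun F => (σ.msgs d Q F, bits C F)) ≤
      entropy (fun F => (σ.msgs d Q F, bits (C ∪ C₁) F)) :=
    entropy_le_of_factorsThrough fun F F' h => by
      simp only [Prod.mk.injEq] at h ⊢
      exact ⟨h.1, bits_factorsThrough Finset.subset_union_left h.2⟩
  rw [entropy_bits, entropy_bits] at hsub
  have hcard : ((C ∪ C₁).card : ℝ) ≤ C.card + (σ.bitsOf (P \ S)).card := by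
    have : C ∪ C₁ ⊆ C ∪ σ.bitsOf (P \ S) := by
      intro b
      simp only [hC, hC₁, Finset.mem_union, mem_bitsOf, Finset.mem_sdiff]
      tauto
    exact_mod_cast (Finset.card_le_card this).trans (Finset.card_union_le _ _)
  rw [entropyGivenCompl_eq]
  linarith

/-- Han's inequality for the messages conditioned on the bits in `C`; subtracting |C| turns joint
entropies into conditional ones. -/
lemma msgs_han (d : Demand H r N) (C : Finset (Fin N × Fin σ.B)) {b : ℕ} (hb : 1 ≤ b) :
    ((H - 1).choose (b - 1) : ℝ) *
      (entropy (fun F => (σ.msgs d Finset.univ F, bits C F)) - C.card) ≤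
      ∑ Q ∈ Finset.univ.filter (fun Q : Finset (Fin H) => Q.card = b),
        (entropy (fun F => (σ.msgs d Q F, bits C F)) - C.card) := by
  have hempty : entropy (fun F => (σ.msgs d ∅ F, bits C F)) = C.card := by
    rw [← entropy_bits]
    exact entropy_congr
      (fun F F' h => Prod.ext (funext fun h' => absurd h'.2 (Finset.notMem_empty _)) h)
      (fun F F' h => (Prod.ext_iff.1 h).2)
  have key := han_inequality (fun Q => entropy (fun F => (σ.msgs d Q F, bits C F))) ?_ hb
  · simpa only [hempty] using key
  intro S T a hST _
  have hmsgs : ∀ {A B : Finset (Fin H)} {F F' : Library N σ.B}, A ⊆ B →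
      σ.msgs d B F = σ.msgs d B F' → σ.msgs d A F = σ.msgs d A F' :=
    fun hAB h => funext fun i => congrFun h ⟨i.1, hAB i.2⟩
  have hsub : entropy (fun F => (σ.msgs d (insert a T) F, bits C F)) +
      entropy (fun F => (σ.msgs d S F, bits C F)) ≤
      entropy (fun F => (σ.msgs d (insert a S) F, bits C F)) +
      entropy (fun F => (σ.msgs d T F, bits C F)) := by
    refine entropy_submodular (fun F F' h => ?_) (fun F F' h => ?_) (fun F F' h => ?_)
    · simp only [Prod.mk.injEq] at h ⊢
      exact ⟨hmsgs (Finset.subset_insert _ _) h.1, h.2⟩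
    · simp only [Prod.mk.injEq] at h ⊢
      exact ⟨hmsgs hST h.1, h.2⟩
    · simp only [Prod.mk.injEq] at h ⊢
      refine ⟨funext fun i => ?_, h.1.2⟩
      rcases Finset.mem_insert.1 i.2 with hi | hi
      · exact congrFun h.1.1 ⟨i.1, by rw [hi]; exact Finset.mem_insert_self _ _⟩
      · exact congrFun h.2.1 ⟨i.1, hi⟩
  linarith

/-- Han's inequality given Pᶜ, with all users decoding P from all messages, followed by the change
of conditioning for each `Q`. A sub-file of P is missing from `S Q` only if `K_Q` meets its owners
or its requester, so it is lost for at most as many `Q` as `coeff` subtracts. -/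
lemma sum_coeff_mul_card_le (hσ : σ.OnlyRequested) {d : Demand H r N}
    (hd : Function.Injective d) {δ e : ℝ} (h0 : 0 < δ) (h1 : δ < 1)
    (he : ∀ k, σ.errorProb d k ≤ e) {p : List (User H r)} (hp : p.Nodup)
    {b : ℕ} (hb : 1 ≤ b) :
    ∑ t ∈ acyclicIndex p, coeff ({p.get t.1} ∪ t.2) b *
        ((σ.subfile (d (p.get t.1)) t.2).card : ℝ) ≤
      ∑ Q ∈ Finset.univ.filter (fun Q : Finset (Fin H) => Q.card = b),
        σ.entropyGivenCompl d Q (acyclicSet d (Finset.univ \ usersOf r Q)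
          (subvector (Finset.univ \ usersOf r Q) p)) +
      ((H - 1).choose (b - 1) : ℝ) * (p.length * (σ.B * equivocation δ e)) := by
  classical
  set m : ℝ := ((H - 1).choose (b - 1) : ℝ) with hm
  set c : (Σ _ : Fin p.length, Finset (User H r)) → ℝ :=
    fun t => coeff ({p.get t.1} ∪ t.2) b with hc
  set f : (Σ _ : Fin p.length, Finset (User H r)) → ℝ :=
    fun t => ((σ.subfile (d (p.get t.1)) t.2).card : ℝ) with hf
  let S : Finset (Fin H) → Finset (Fin N × Finset (User H r)) := fun Q =>
    acyclicSet d (Finset.univ \ usersOf r Q) (subvector (Finset.univ \ usersOf r Q) p)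
  -- Only sub-files with positive coefficient are kept, so that the truncation at 0 in `coeff` never
  -- hides a negative term.
  let J := (acyclicIndex p).filter fun t => 0 < c t
  let P := J.image (subfileIndex d p)
  set C := σ.bitsOf (requested d \ P) with hC
  set B : Finset (Finset (Fin H)) := Finset.univ.filter fun Q : Finset (Fin H) => Q.card = b
  have hPS : P ⊆ acyclicSet d Finset.univ p := by
    rw [← image_subfileIndex]
    exact Finset.image_subset_image (Finset.filter_subset _ _)
  have hPcard : ((σ.bitsOf P).card : ℝ) = ∑ t ∈ J, f t := σ.card_bitsOf_image hd hp J
  have hdiff : ∀ Q, ((σ.bitsOf (P \ S Q)).card : ℝ) ≤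
      ∑ t ∈ J, if ¬ usersOf r Q ⊆ Finset.univ \ ({p.get t.1} ∪ t.2) then f t else 0 := by
    intro Q
    rw [← Finset.sum_filter]
    have hsub : P \ S Q ⊆ (J.filter fun t =>
        ¬ usersOf r Q ⊆ Finset.univ \ ({p.get t.1} ∪ t.2)).image (subfileIndex d p) := by
      intro s hs
      obtain ⟨hsP, hsS⟩ := Finset.mem_sdiff.1 hs
      obtain ⟨t, ht, rfl⟩ := Finset.mem_image.1 hsP
      refine Finset.mem_image.2 ⟨t, Finset.mem_filter.2 ⟨ht, fun hK => hsS ?_⟩, rfl⟩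
      have htI := (Finset.mem_sigma.1 (Finset.mem_filter.1 ht).1).2
      have hK' : ∀ k ∈ {p.get t.1} ∪ t.2, k ∈ Finset.univ \ usersOf r Q := fun k hk =>
        Finset.mem_sdiff.2 ⟨Finset.mem_univ _, fun hkQ => (Finset.mem_sdiff.1 (hK hkQ)).2 hk⟩
      refine mem_acyclicSet_subvector (S := Finset.univ) (l₁ := p.take t.1)
        (k := p.get t.1) (l₂ := p.drop (t.1 + 1)) (by simp) rfl ?_
        (hK' _ (by simp)) (fun k hk => hK' k (by simp [subfileIndex] at hk; simp [hk]))
      simpa [subfileIndex] using htI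
    calc ((σ.bitsOf (P \ S Q)).card : ℝ) ≤ ((σ.bitsOf ((J.filter fun t =>
        ¬ usersOf r Q ⊆ Finset.univ \ ({p.get t.1} ∪ t.2)).image (subfileIndex d p))).card : ℝ) := by
          exact_mod_cast Finset.card_le_card (Finset.biUnion_subset_biUnion_of_subset_left _ hsub)
      _ = _ := σ.card_bitsOf_image hd hp _
  have hdec := σ.entropy_decode_acyclic_le hσ h0 h1 he (p := p) (Q := Finset.univ)
    (fun k _ => Finset.subset_univ _) (P := P) (S₂ := ∅) hPS (by simp) (C := C) (by simp [hC])
  have hall : (C.card : ℝ) + (σ.bitsOf P).card ≤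
      entropy (fun F => (σ.msgs d Finset.univ F, bits (C ∪ σ.bitsOf P) F)) := by
    refine le_trans (le_of_eq ?_) (σ.entropy_prod_msgs_bits_ge d Finset.univ _)
    rw [Finset.card_union_of_disjoint]
    · push_cast; rfl
    · rw [Finset.disjoint_left]
      intro x hx hx'
      rw [mem_bitsOf] at hx'
      rw [hC, mem_bitsOf, Finset.mem_sdiff] at hx
      exact hx.2 hx'
  have hm0 : 0 ≤ m := by positivity
  have hhan := σ.msgs_han d C hb
  have h2 : m * ((σ.bitsOf P).card - p.length * (σ.B * equivocation δ e)) ≤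
      m * (entropy (fun F => (σ.msgs d Finset.univ F, bits C F)) - C.card) :=
    mul_le_mul_of_nonneg_left (by linarith) hm0
  have h3 : ∑ Q ∈ B, (entropy (fun F => (σ.msgs d Q F, bits C F)) - C.card) ≤
      ∑ Q ∈ B, (σ.entropyGivenCompl d Q (S Q) +
        ∑ t ∈ J, if ¬ usersOf r Q ⊆ Finset.univ \ ({p.get t.1} ∪ t.2) then f t else 0) := by
    refine Finset.sum_le_sum fun Q _ => ?_
    have := σ.entropyGivenCompl_ge (d := d) (Q := Q) P (S Q)
    linarith [hdiff Q]
  have h4 : ∑ Q ∈ B, ∑ t ∈ J, (if ¬ usersOf r Q ⊆ Finset.univ \ ({p.get t.1} ∪ t.2) then f t else 0)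
      = ∑ t ∈ J, ((B.filter fun Q =>
        ¬ usersOf r Q ⊆ Finset.univ \ ({p.get t.1} ∪ t.2)).card : ℝ) * f t := by
    rw [Finset.sum_comm]
    refine Finset.sum_congr rfl fun t _ => ?_
    rw [← Finset.sum_filter, Finset.sum_const, nsmul_eq_mul]
  have h5 : ∑ t ∈ acyclicIndex p, c t * f t = ∑ t ∈ J, (m * f t - ((B.filter fun Q =>
        ¬ usersOf r Q ⊆ Finset.univ \ ({p.get t.1} ∪ t.2)).card : ℝ) * f t) := by
    rw [Finset.sum_filter]
    refine Finset.sum_congr rfl fun t _ => ?_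
    have hct : c t = max (m - ((B.filter fun Q =>
        ¬ usersOf r Q ⊆ Finset.univ \ ({p.get t.1} ∪ t.2)).card : ℝ)) 0 := by
      simp only [hc, coeff, B, Finset.filter_filter, hm]
    split_ifs with h
    · rw [hct] at h ⊢
      rw [max_eq_left (by
        by_contra hneg
        rw [max_eq_right (not_le.1 hneg).le] at h
        exact lt_irrefl _ h), sub_mul]
    · rw [show c t = 0 from le_antisymm (not_lt.1 h) (hct ▸ le_max_right _ _), zero_mul]
  rw [Finset.sum_add_distrib, h4] at h3
  rw [Finset.sum_sub_distrib, ← Finset.mul_sum, ← hPcard] at h5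
  change ∑ t ∈ acyclicIndex p, c t * f t ≤ ∑ Q ∈ B, σ.entropyGivenCompl d Q (S Q) + _
  rw [h5]
  linarith

/-- The cut-set type bound for a single scheme. -/
lemma sum_x_add_y_le (hσ : σ.OnlyRequested) (hN : H.choose r ≤ N) (hN0 : 0 < N)
    {δ e : ℝ} (h0 : 0 < δ) (h1 : δ < 1) (he : ∀ d k, σ.errorProb d k ≤ e)
    {Q : Finset (Fin H)} {p : List (User H r)} (hp : IsPerm p (usersOf r Q)) :
    (∑ i : Fin p.length, ∑ W ∈ (Finset.univ \ (p.take (i + 1)).toFinset).powerset, σ.x W) +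
      σ.y Q ≤ Q.card * σ.load + p.length * equivocation δ e := by
  rw [add_comm, ← le_sub_iff_add_le]
  -- The permutation `v` in `y` is unrelated to `p`, and the bound holds for each `v`, so passing to
  -- the maximum is free.
  refine σ.y_le_of_forall fun v _ => ?_
  have hB := σ.B_pos_real
  have hD := descFactorial_pos_real hN
  have hsum := Finset.sum_le_sum fun d (hd : d ∈ injDemands H r N) =>
    σ.card_bitsOf_acyclicSet_add_le hσ (Finset.mem_filter.1 hd).2 h0 h1 (he d) hp v
  rw [Finset.sum_add_distrib, Finset.sum_const, card_injDemands, nsmul_eq_mul] at hsum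
  have hS : ∑ d ∈ injDemands H r N, ((σ.bitsOf (acyclicSet d Finset.univ p)).card : ℝ) =
      σ.B * N.descFactorial (H.choose r) * ∑ i : Fin p.length,
        ∑ W ∈ (Finset.univ \ (p.take (i + 1)).toFinset).powerset, σ.x W := by
    rw [Finset.sum_sigma' Finset.univ
      (fun i : Fin p.length => (Finset.univ \ (p.take (i + 1)).toFinset).powerset)
      (fun _ W => σ.x W), Finset.mul_sum]
    rw [Finset.sum_congr rfl fun d hd => by
      rw [← image_subfileIndex, σ.card_bitsOf_image (Finset.mem_filter.1 hd).2 hp.1],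
      Finset.sum_comm]
    exact Finset.sum_congr rfl fun t _ => σ.sum_injDemands_card_subfile hN0 _ _
  rw [hS] at hsum
  unfold yPerm
  rw [div_le_iff₀ (by positivity)]
  linarith

/-- The bound on the terms `y_Q` for a single scheme. -/
lemma sum_coeff_mul_x_le (hσ : σ.OnlyRequested) (hN : H.choose r ≤ N) (hN0 : 0 < N)
    {δ e : ℝ} (h0 : 0 < δ) (h1 : δ < 1) (he : ∀ d k, σ.errorProb d k ≤ e)
    {p : List (User H r)} (hp : IsPerm p Finset.univ) {b : ℕ} (hb : 1 ≤ b) :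
    ∑ i : Fin p.length, ∑ W ∈ (Finset.univ \ (p.take (i + 1)).toFinset).powerset,
        coeff ({p.get i} ∪ W) b * σ.x W ≤
      ∑ Q ∈ Finset.univ.filter (fun Q : Finset (Fin H) => Q.card = b), σ.y Q +
        (((H - 1).choose (b - 1) : ℝ) * p.length) * equivocation δ e := by
  have hB := σ.B_pos_real
  have hD := descFactorial_pos_real hN
  have hsum := Finset.sum_le_sum fun d (hd : d ∈ injDemands H r N) =>
    σ.sum_coeff_mul_card_le hσ (Finset.mem_filter.1 hd).2 h0 h1 (he d) hp.1 hb
  rw [Finset.sum_comm, Finset.sum_add_distrib, Finset.sum_const, card_injDemands, nsmul_eq_mul,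
    Finset.sum_comm (s := injDemands H r N)] at hsum
  have hl : ∑ t ∈ acyclicIndex p, ∑ d ∈ injDemands H r N, coeff ({p.get t.1} ∪ t.2) b *
      ((σ.subfile (d (p.get t.1)) t.2).card : ℝ) =
      σ.B * N.descFactorial (H.choose r) *
        ∑ i : Fin p.length, ∑ W ∈ (Finset.univ \ (p.take (i + 1)).toFinset).powerset,
        coeff ({p.get i} ∪ W) b * σ.x W := by
    rw [Finset.sum_sigma' Finset.univ
      (fun i : Fin p.length => (Finset.univ \ (p.take (i + 1)).toFinset).powerset)
      (fun i W => coeff ({p.get i} ∪ W) b * σ.x W), Finset.mul_sum]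
    refine Finset.sum_congr rfl fun t _ => ?_
    rw [← Finset.mul_sum, σ.sum_injDemands_card_subfile hN0]
    ring
  rw [hl] at hsum
  -- Here one permutation `p` serves all `Q`, and each `y_{Q,p}` is bounded by the maximum.
  have hy : ∑ Q ∈ Finset.univ.filter (fun Q : Finset (Fin H) => Q.card = b),
      ∑ d ∈ injDemands H r N, σ.entropyGivenCompl d Q (acyclicSet d (Finset.univ \ usersOf r Q)
          (subvector (Finset.univ \ usersOf r Q) p)) ≤
      σ.B * N.descFactorial (H.choose r) *
      ∑ Q ∈ Finset.univ.filter (fun Q : Finset (Fin H) => Q.card = b), σ.y Q := by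
    rw [Finset.mul_sum]
    refine Finset.sum_le_sum fun Q _ => ?_
    have := σ.yPerm_le_y hN Q hp
    rw [yPerm, div_le_iff₀ (by positivity)] at this
    linarith
  refine le_of_mul_le_mul_left (a := σ.B * (N.descFactorial (H.choose r) : ℝ)) ?_ (by positivity)
  linarith

end Scheme

/-! ### Limits of the outer bounds -/

section Limit

variable {H r N : ℕ} {M : ℝ}

lemma tendsto_equivocation_zero :
    Tendsto (fun δ : ℝ => Scheme.equivocation δ 0) (𝓝[>] 0) (𝓝 0) := by
  have h : ContinuousAt (fun δ : ℝ => Scheme.equivocation δ 0) 0 := by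
    unfold Scheme.equivocation Real.logb
    refine ContinuousAt.add ?_ (by simpa using continuousAt_const)
    refine ContinuousAt.neg (ContinuousAt.div_const ?_ _)
    exact ContinuousAt.log (by fun_prop) (by norm_num)
  have h' := h.tendsto.mono_left (nhdsWithin_le_nhds (s := Set.Ioi (0 : ℝ)))
  simpa [Scheme.equivocation] using h'

/-- The order of limits matters: first the error tends to 0 with δ fixed, which kills the term with
log δ, then δ tends to 0. -/
lemma le_of_equivocation_bound {a c : ℕ → ℝ} {e : ℕ → ℝ} {a' c' m : ℝ}
    (ha : Tendsto a atTop (𝓝 a')) (hc : Tendsto c atTop (𝓝 c')) (he : Tendsto e atTop (𝓝 0))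
    (h : ∀ δ : ℝ, 0 < δ → δ < 1 → ∀ n, a n ≤ c n + m * Scheme.equivocation δ (e n)) : a' ≤ c' := by
  have h1 : ∀ δ : ℝ, 0 < δ → δ < 1 → a' ≤ c' + m * Scheme.equivocation δ 0 := by
    intro δ h0 h1
    refine le_of_tendsto_of_tendsto' ha (hc.add (Tendsto.const_mul m ?_)) (h δ h0 h1)
    exact tendsto_const_nhds.add (he.mul_const _)
  have h2 : Tendsto (fun δ : ℝ => c' + m * Scheme.equivocation δ 0) (𝓝[>] 0) (𝓝 c') := by
    simpa using tendsto_const_nhds.add (tendsto_equivocation_zero.const_mul m)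
  refine ge_of_tendsto h2 ?_
  filter_upwards [Ioo_mem_nhdsGT (zero_lt_one' ℝ)] with δ hδ
  exact h1 δ hδ.1 hδ.2

lemma isAsymptotic_outer_bounds (hr : 1 ≤ r) (hrH : r ≤ H) (hN : H.choose r ≤ N) {R : ℝ}
    {x : Finset (User H r) → ℝ} {y : Finset (Fin H) → ℝ} (h : IsAsymptotic H r N M R x y) :
    (∑ W, x W = 1) ∧
    (∀ k : User H r,
      ∑ W ∈ Finset.univ.filter (fun W : Finset (User H r) => k ∈ W), x W ≤ M / N) ∧
    ∀ b : ℕ, r ≤ b → b ≤ H →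
      (∀ Q : Finset (Fin H), Q.card = b →
        ∀ p : List (User H r), IsPerm p (usersOf r Q) →
          (∑ i : Fin p.length,
            ∑ W ∈ (Finset.univ \ (p.take (i + 1)).toFinset).powerset, x W) + y Q
          ≤ (Q.card : ℝ) * R) ∧
      (∀ p : List (User H r), IsPerm p Finset.univ →
        (∑ i : Fin p.length,
          ∑ W ∈ (Finset.univ \ (p.take (i + 1)).toFinset).powerset,
            coeff ({p.get i} ∪ W) b * x W)
        ≤ ∑ Q ∈ Finset.univ.filter (fun Q : Finset (Fin H) => Q.card = b), y Q) := by
  obtain ⟨σ, hσ, herr, hload, hx, hy⟩ := h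
  have hN0 : 0 < N := (Nat.choose_pos hrH).trans_le hN
  -- The sum over all demands and users is a single bound on every error probability that still
  -- tends to 0.
  set e : ℕ → ℝ := fun n => ∑ d : Demand H r N, ∑ k, (σ n).errorProb d k with he
  have he0 : Tendsto e atTop (𝓝 0) := by
    have := tendsto_finsetSum (Finset.univ : Finset (Demand H r N)) fun d _ =>
      tendsto_finsetSum (Finset.univ : Finset (User H r)) fun k _ => herr d k
    simpa using this
  have hle : ∀ n d k, (σ n).errorProb d k ≤ e n := by
    intro n d k
    exact (Finset.single_le_sum (f := fun k => (σ n).errorProb d k)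
      (fun _ _ => unifProb_nonneg _) (Finset.mem_univ k)).trans
      (Finset.single_le_sum (f := fun d => ∑ k, (σ n).errorProb d k)
      (fun _ _ => Finset.sum_nonneg fun _ _ => unifProb_nonneg _) (Finset.mem_univ d))
  refine ⟨?_, fun k => ?_, fun b hrb _ => ⟨fun Q _ p hp => ?_, fun p hp => ?_⟩⟩
  · refine tendsto_nhds_unique (tendsto_finsetSum _ fun W _ => hx W) ?_
    simp only [Scheme.sum_x _ hN0]
    exact tendsto_const_nhds
  · exact le_of_tendsto' (tendsto_finsetSum _ fun W _ => hx W) fun n => (σ n).sum_x_mem_le k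
  · exact le_of_equivocation_bound
      ((tendsto_finsetSum _ fun i _ => tendsto_finsetSum _ fun W _ => hx W).add (hy Q))
      (hload.const_mul _) he0
      fun δ h0 h1 n => (σ n).sum_x_add_y_le (hσ n) hN hN0 h0 h1 (hle n) hp
  · exact le_of_equivocation_bound
      (tendsto_finsetSum _ fun i _ => tendsto_finsetSum _ fun W _ => (hx W).const_mul _)
      (tendsto_finsetSum _ fun Q _ => hy Q) he0
      fun δ h0 h1 n => (σ n).sum_coeff_mul_x_le (hσ n) hN hN0 h0 h1 (hle n) hp (hr.trans hrb)

end Limit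

/-! ### Schemes whose messages only depend on the requested sub-files -/

namespace Scheme

variable {H r N : ℕ} {M : ℝ} (σ : Scheme H r N M)

/-- The `j`-th bit of the file of user `k`: that of the estimate `f` if it is requested, and the
cached one otherwise. -/
def restore (d : Demand H r N) (k : User H r) (c : {b // b ∈ σ.cache k} → Bool)
    (f : Fin σ.B → Bool) (j : Fin σ.B) : Bool :=
  if (d k, j) ∈ σ.bitsOf (requested d) then f j
  else if hb : (d k, j) ∈ σ.cache k then c ⟨(d k, j), hb⟩ else false

lemma restore_eq {d : Demand H r N} {k : User H r} {f : Fin σ.B → Bool} {u F : Library N σ.B}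
    (hf : f = fun j => patch (σ.bitsOf (requested d)) u F (d k, j)) :
    σ.restore d k (fun b => F b.1) f = fun j => F (d k, j) := by
  funext j
  unfold restore
  by_cases hj : (d k, j) ∈ σ.bitsOf (requested d)
  · rw [if_pos hj, hf]
    exact patch_of_mem hj
  -- A bit of the file demanded by `k` that is not requested must be in the cache of `k`, so the
  -- default `false` of `restore` is never used.
  · have : (d k, j) ∈ σ.cache k := by
      by_contra h
      exact hj (σ.mem_bitsOf_requested.2 ⟨k, rfl, h⟩)
    rw [if_neg hj, dif_pos this]

/-- The scheme in which the bits that are not requested under `d` are replaced by those of `u d`;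
the users restore from their caches the bits of their files that are not requested. -/
def mask (u : Demand H r N → Library N σ.B) : Scheme H r N M where
  B := σ.B
  B_pos := σ.B_pos
  cache := σ.cache
  cache_card := σ.cache_card
  relayBits := σ.relayBits
  toRelay d h F := σ.toRelay d h (patch (σ.bitsOf (requested d)) (u d) F)
  linkBits := σ.linkBits
  toUser := σ.toUser
  decode d k c m := σ.restore d k c (σ.decode d k
    (fun b => if b.1 ∈ σ.bitsOf (requested d) then c b else u d b.1) m)

lemma mask_onlyRequested (u : Demand H r N → Library N σ.B) : (σ.mask u).OnlyRequested := by
  intro d h F F' hF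
  exact congrArg (σ.toRelay d h) (patch_eq_patch_iff.2 hF)

lemma mask_load (u : Demand H r N → Library N σ.B) : (σ.mask u).load = σ.load := rfl

lemma mask_errorProb_le (u : Demand H r N → Library N σ.B) (d : Demand H r N) (k : User H r) :
    (σ.mask u).errorProb d k ≤ unifProb fun F : Library N σ.B =>
      σ.output d k (patch (σ.bitsOf (requested d)) (u d) F) ≠
        fun j => patch (σ.bitsOf (requested d)) (u d) F (d k, j) := by
  exact unifProb_mono fun F hF hout => hF (σ.restore_eq hout)

/-- For each demand vector the unrequested bits are fixed to values known to server and users,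
chosen so that no user's error exceeds the total error of the original scheme. Loads and caches stay
the same. -/
lemma exists_onlyRequested :
    ∃ σ' : Scheme H r N M, σ'.OnlyRequested ∧ σ'.load = σ.load ∧
      ∀ d k, σ'.errorProb d k ≤ ∑ k', σ.errorProb d k' := by
  choose u hu using fun d : Demand H r N =>
    exists_patch_unifProb_le (σ.bitsOf (requested d)) (κ := User H r)
      (fun k (F : Library N σ.B) => σ.output d k F ≠ fun j => F (d k, j))
  exact ⟨σ.mask u, σ.mask_onlyRequested u, σ.mask_load u, fun d k =>
    (σ.mask_errorProb_le u d k).trans (hu d k)⟩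

/-- The scheme without caching, in which all files are sent over all links. -/
def broadcast (H r N : ℕ) {M : ℝ} (hr : 1 ≤ r) (hM : 0 ≤ M) : Scheme H r N M where
  B := 1
  B_pos := one_pos
  cache _ := ∅
  cache_card _ := by simpa using hM
  relayBits _ _ := N
  toRelay _ _ F i := F (i, 0)
  linkBits _ _ := N
  toUser _ _ m := m
  decode d k _ m _ :=
    m ⟨(Finset.card_pos.1 (k.2.symm ▸ hr)).choose, (Finset.card_pos.1 (k.2.symm ▸ hr)).choose_spec⟩
      (d k)

lemma broadcast_errorProb (hr : 1 ≤ r) (hM : 0 ≤ M) (d : Demand H r N) (k : User H r) :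
    (broadcast H r N hr hM).errorProb d k = 0 := by
  have : ∀ F, (broadcast H r N hr hM).output d k F = fun j => F (d k, j) := by
    intro F
    funext j
    have hj : j = (0 : Fin 1) := Subsingleton.elim (α := Fin 1) _ _
    rw [hj]
    rfl
  simp [errorProb, this, unifProb]

end Scheme

/-! ### Attaining the optimal load along a convergent sequence of schemes -/

section Existence

variable {H r N : ℕ} {M : ℝ}

lemma bddBelow_achievable : BddBelow {R : ℝ | Achievable H r N M R} :=
  ⟨0, fun _ hR => by
    obtain ⟨σ, hσ, -⟩ := hR 1 one_pos
    exact σ.load_nonneg.trans hσ⟩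

lemma achievable_nonempty (hr : 1 ≤ r) (hM : 0 ≤ M) : {R : ℝ | Achievable H r N M R}.Nonempty :=
  ⟨(Scheme.broadcast H r N hr hM).load, fun _ hε => ⟨Scheme.broadcast H r N hr hM, le_rfl,
    fun d k => (Scheme.broadcast_errorProb hr hM d k).trans_le hε.le⟩⟩

lemma exists_onlyRequested_load_lt (hr : 1 ≤ r) (hM : 0 ≤ M) {ε : ℝ} (hε : 0 < ε) :
    ∃ σ : Scheme H r N M, σ.OnlyRequested ∧ σ.load < optimalLoad H r N M + ε ∧
      ∀ d k, σ.errorProb d k ≤ Fintype.card (User H r) * ε := by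
  obtain ⟨R, hR, hlt⟩ := exists_lt_of_csInf_lt (achievable_nonempty (H := H) (N := N) hr hM)
    (lt_add_of_pos_right (sInf {R : ℝ | Achievable H r N M R}) hε)
  obtain ⟨σ, hσ, herr⟩ := hR ε hε
  obtain ⟨σ', h1, h2, h3⟩ := σ.exists_onlyRequested
  refine ⟨σ', h1, h2.trans_lt (hσ.trans_lt hlt), fun d k => (h3 d k).trans ?_⟩
  refine (Finset.sum_le_sum fun k' _ => herr d k').trans (le_of_eq ?_)
  rw [Finset.sum_const, Finset.card_univ, nsmul_eq_mul]

lemma exists_isAsymptotic_optimalLoad (hr : 1 ≤ r) (hrH : r ≤ H) (hN : H.choose r ≤ N)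
    (hM : 0 ≤ M) :
    ∃ (x : Finset (User H r) → ℝ) (y : Finset (Fin H) → ℝ),
      IsAsymptotic H r N M (optimalLoad H r N M) x y := by
  have hN0 : 0 < N := (Nat.choose_pos hrH).trans_le hN
  choose σ hσ hload herr using fun n : ℕ =>
    exists_onlyRequested_load_lt (H := H) (N := N) (M := M) hr hM (Nat.one_div_pos_of_nat (n := n))
  have hlim := tendsto_one_div_add_atTop_nhds_zero_nat (𝕜 := ℝ)
  have herr0 : Tendsto (fun n : ℕ => (Fintype.card (User H r) : ℝ) * (1 / ((n : ℝ) + 1)))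
      atTop (𝓝 0) := by simpa using hlim.const_mul (Fintype.card (User H r) : ℝ)
  have hE : ∀ d k, Tendsto (fun n => (σ n).errorProb d k) atTop (𝓝 0) := fun d k =>
    squeeze_zero (fun n => unifProb_nonneg _) (fun n => herr n d k) herr0
  have hL : Tendsto (fun n => (σ n).load) atTop (𝓝 (optimalLoad H r N M)) := by
    refine tendsto_order.2 ⟨fun a ha => ?_, fun a ha => ?_⟩
    -- If loads at most `a` recurred infinitely often, the vanishing errors would make `a`
    -- achievable, although it lies below the infimum.
    · by_contra hcon
      have hfreq : ∃ᶠ n in atTop, (σ n).load ≤ a := by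
        simpa only [Filter.Frequently, not_le] using hcon
      have : Achievable H r N M a := by
        intro ε hε
        obtain ⟨n, hn, hn'⟩ := (hfreq.and_eventually (herr0.eventually (gt_mem_nhds hε))).exists
        exact ⟨σ n, hn, fun d k => (herr n d k).trans hn'.le⟩
      exact absurd (csInf_le bddBelow_achievable this) (not_le.2 ha)
    · have : Tendsto (fun n : ℕ => optimalLoad H r N M + 1 / ((n : ℝ) + 1)) atTop
          (𝓝 (optimalLoad H r N M)) := by simpa using tendsto_const_nhds.add hlim
      filter_upwards [this.eventually (gt_mem_nhds ha)] with n hn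
      exact (hload n).trans hn
  obtain ⟨c, hc⟩ := hL.bddAbove_range
  have hc' : ∀ n, (σ n).load ≤ c := fun n => hc ⟨n, rfl⟩
  -- All `x_W` and `y_Q` stay in a fixed compact box, because the convergent loads are bounded by
  -- `c`.
  let K : Set ((Finset (User H r) → ℝ) × (Finset (Fin H) → ℝ)) :=
    Set.univ.pi (fun _ => Set.Icc 0 1) ×ˢ Set.univ.pi (fun Q => Set.Icc 0 (Q.card * c))
  have hK : IsCompact K :=
    (isCompact_univ_pi fun _ => isCompact_Icc).prod (isCompact_univ_pi fun _ => isCompact_Icc)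
  obtain ⟨⟨x, y⟩, -, φ, hφ, hlimit⟩ := hK.tendsto_subseq
    (x := fun n => ((σ n).x, (σ n).y)) fun n =>
      ⟨fun W _ => ⟨(σ n).x_nonneg W, (σ n).x_le_one hN0 W⟩,
        fun Q _ => ⟨(σ n).y_nonneg hN Q, ((σ n).y_le hN Q).trans
          (mul_le_mul_of_nonneg_left (hc' n) (Nat.cast_nonneg _))⟩⟩
  have hx := tendsto_pi_nhds.1 ((continuous_fst.tendsto _).comp hlimit)
  have hy := tendsto_pi_nhds.1 ((continuous_snd.tendsto _).comp hlimit)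
  exact ⟨x, y, σ ∘ φ, fun n => hσ _, fun d k => (hE d k).comp hφ.tendsto_atTop,
    hL.comp hφ.tendsto_atTop, hx, hy⟩

end Existence
end
end CombNet

theorem mainTheorem4 (H r N : ℕ) (M : ℝ) (hr : 1 ≤ r) (hrH : r ≤ H) (hN : H.choose r ≤ N)
    (hM0 : 0 ≤ M) (hMN : M ≤ N) :
    (∃ (x : Finset (CombNet.User H r) → ℝ) (y : Finset (Fin H) → ℝ),
      CombNet.IsAsymptotic H r N M (CombNet.optimalLoad H r N M) x y) ∧
    ∀ (R : ℝ) (x : Finset (CombNet.User H r) → ℝ) (y : Finset (Fin H) → ℝ),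
      CombNet.IsAsymptotic H r N M R x y →
        (∑ W, x W = 1) ∧
        (∀ k : CombNet.User H r,
          ∑ W ∈ Finset.univ.filter (fun W : Finset (CombNet.User H r) => k ∈ W), x W ≤ M / N) ∧
        ∀ b : ℕ, r ≤ b → b ≤ H →
          (∀ Q : Finset (Fin H), Q.card = b →
            ∀ p : List (CombNet.User H r), CombNet.IsPerm p (CombNet.usersOf r Q) →
              (∑ i : Fin p.length,
                ∑ W ∈ (Finset.univ \ (p.take (i + 1)).toFinset).powerset, x W) + y Q
              ≤ (Q.card : ℝ) * R) ∧
          (∀ p : List (CombNet.User H r), CombNet.IsPerm p Finset.univ →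
            (∑ i : Fin p.length,
              ∑ W ∈ (Finset.univ \ (p.take (i + 1)).toFinset).powerset,
                CombNet.coeff ({p.get i} ∪ W) b * x W)
            ≤ ∑ Q ∈ Finset.univ.filter (fun Q : Finset (Fin H) => Q.card = b), y Q) :=
  ⟨CombNet.exists_isAsymptotic_optimalLoad hr hrH hN hM0,
    fun _ _ _ h => CombNet.isAsymptotic_outer_bounds hr hrH hN h⟩
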